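/- Let $t_1,t_2,r_2,r_3$ be nonnegative integers, let $G_{21}\in\mathbb{C}^{r_2\times t_1}$, $G_{31}\in\mathbb{C}^{r_3\times t_1}$, $G_{32}\in\mathbb{C}^{r_3\times t_2}$ and let $P\ge 0$. Consider the MIMO Gaussian relay channel with inputs $\mathbf X_1\in\mathbb{C}^{t_1}$ (sender) and $\mathbf X_2\in\mathbb{C}^{t_2}$ (relay) and outputs $$\mathbf Y_2=G_{21}\mathbf X_1+\mathbf Z_2\ \text{(relay)},\qquad \mathbf Y_3=G_{31}\mathbf X_1+G_{32}\mathbf X_2+\mathbf Z_3\ \text{(receiver)},$$ where $\mathbf Z_2\sim\mathrm{CN}(0,I_{r_2})$ and $\mathbf Z_3\sim\mathrm{CN}(0,I_{r_3})$ are circularly symmetric complex Gaussian vectors, independent of each other and of the inputs. All (conditional) mutual informations are in bits. Define the cutset bound $$R_{\mathrm{CS}}=\sup_{F(\mathbf x_1,\mathbf x_2)}\min\bigl\{I(\mathbf X_1,\mathbf X_2;\mathbf Y_3),\ I(\mathbf X_1;\mathbf Y_2,\mathbf Y_3\mid\mathbf X_2)\bigr\},$$ the supremum being over all joint distributions of $(\mathbf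 X_1,\mathbf X_2)$ such that $\mathrm{E}(\mathbf X_j^{\mathsf H}\mathbf X_j)\le P$ for $j=1,2$, and the partial decode--forward lower bound $$R_{\mathrm{PDF}}=\sup_{F(\mathbf u,\mathbf x_1,\mathbf x_2)}\min\bigl\{I(\mathbf X_1,\mathbf X_2;\mathbf Y_3),\ I(\mathbf U;\mathbf Y_2\mid\mathbf X_2)+I(\mathbf X_1;\mathbf Y_3\mid\mathbf X_2,\mathbf U)\bigr\},$$ the supremum being over all joint distributions of $(\mathbf U,\mathbf X_1,\mathbf X_2)$ such that $\mathrm{E}(\mathbf X_j^{\mathsf H}\mathbf X_j)\le P$ for $j=1,2$, where the auxiliary vector $\mathbf U$ is a complex random vector of arbitrary finite dimension and $(\mathbf Z_2,\mathbf Z_3)$ is independent of $(\mathbf U,\mathbf X_1,\mathbf X_2)$. Then $R_{\mathrm{CS}}$ and $R_{\mathrm{PDF}}$ are finite and $$R_{\mathrm{CS}}-R_{\mathrm{PDF}}\le\min(t_1,r_2).$$ -/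

import Mathlib

open MeasureTheory ProbabilityTheory InformationTheory
open scoped ENNReal Matrix

noncomputable section

namespace MIMORelay

/-- Mutual information `I(X; Y)` in bits of two random variables on `(Ω, ν)`: the relative entropy
of the joint law with respect to the product of the marginal laws. -/
def mutualInfo {Ω α β : Type*} [MeasurableSpace Ω] [MeasurableSpace α] [MeasurableSpace β]
    (ν : Measure Ω) (X : Ω → α) (Y : Ω → β) : ℝ≥0∞ :=
  klDiv (ν.map fun ω => (X ω, Y ω)) ((ν.map X).prod (ν.map Y)) / ENNReal.ofReal (Real.log 2)

/-- Conditional mutual information `I(X; Y | Z)` in bits: the relative entropy of the joint law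
`P_{Z,X,Y}` with respect to the law `P_Z ⊗ (P_{X|Z} × P_{Y|Z})` under which `X` and `Y` are
conditionally independent given `Z`. -/
def condMutualInfo {Ω α β γ : Type*} [MeasurableSpace Ω]
    [MeasurableSpace α] [StandardBorelSpace α] [Nonempty α]
    [MeasurableSpace β] [StandardBorelSpace β] [Nonempty β] [MeasurableSpace γ]
    (ν : Measure Ω) [IsFiniteMeasure ν] (X : Ω → α) (Y : Ω → β) (Z : Ω → γ) : ℝ≥0∞ :=
  klDiv (ν.map fun ω => (Z ω, (X ω, Y ω)))
      ((ν.map Z) ⊗ₘ (condDistrib X Z ν ×ₖ condDistrib Y Z ν)) /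
    ENNReal.ofReal (Real.log 2)

/-- The standard circularly symmetric complex Gaussian law `CN(0, 1)`: real and imaginary parts
are independent real Gaussians of mean `0` and variance `1 / 2`. -/
def complexGaussian : Measure ℂ :=
  ((gaussianReal 0 (1 / 2)).prod (gaussianReal 0 (1 / 2))).map
    Complex.measurableEquivRealProd.symm

instance : IsProbabilityMeasure complexGaussian :=
  Measure.isProbabilityMeasure_map Complex.measurableEquivRealProd.symm.measurable.aemeasurable

/-- The complex Gaussian law `CN(0, I_r)` on `ℂ ^ r`. -/
def complexGaussianVec (r : ℕ) : Measure (Fin r → ℂ) :=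
  Measure.pi fun _ => complexGaussian

instance (r : ℕ) : IsProbabilityMeasure (complexGaussianVec r) :=
  inferInstanceAs (IsProbabilityMeasure (Measure.pi fun _ : Fin r => complexGaussian))

/-- The joint law of the channel input (of law `μ`) and of the noises `Z₂ ∼ CN(0, I_{r₂})` and
`Z₃ ∼ CN(0, I_{r₃})`, the three being independent. -/
def jointLaw {E : Type*} [MeasurableSpace E] (r₂ r₃ : ℕ) (μ : ProbabilityMeasure E) :
    Measure (E × (Fin r₂ → ℂ) × (Fin r₃ → ℂ)) :=
  (μ : Measure E).prod ((complexGaussianVec r₂).prod (complexGaussianVec r₃))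

instance {E : Type*} [MeasurableSpace E] (r₂ r₃ : ℕ) (μ : ProbabilityMeasure E) :
    IsProbabilityMeasure (jointLaw r₂ r₃ μ) :=
  inferInstanceAs (IsProbabilityMeasure
    ((μ : Measure E).prod ((complexGaussianVec r₂).prod (complexGaussianVec r₃))))

/-- The average power constraint `E(Xᴴ X) ≤ P` for the random vector `X` on `(E, μ)`. -/
def PowerConstraint {E : Type*} [MeasurableSpace E] {t : ℕ} (P : ℝ)
    (μ : ProbabilityMeasure E) (X : E → Fin t → ℂ) : Prop :=
  ∫⁻ e, ∑ i, ‖X e i‖ₑ ^ 2 ∂(μ : Measure E) ≤ ENNReal.ofReal P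

variable {t₁ t₂ r₂ r₃ : ℕ}

/-- The output at the relay, `Y₂ = G₂₁ X₁ + Z₂`. -/
def outputY₂ (G₂₁ : Matrix (Fin r₂) (Fin t₁) ℂ) (x₁ : Fin t₁ → ℂ) (z₂ : Fin r₂ → ℂ) :
    Fin r₂ → ℂ :=
  G₂₁ *ᵥ x₁ + z₂

/-- The output at the receiver, `Y₃ = G₃₁ X₁ + G₃₂ X₂ + Z₃`. -/
def outputY₃ (G₃₁ : Matrix (Fin r₃) (Fin t₁) ℂ) (G₃₂ : Matrix (Fin r₃) (Fin t₂) ℂ)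
    (x₁ : Fin t₁ → ℂ) (x₂ : Fin t₂ → ℂ) (z₃ : Fin r₃ → ℂ) : Fin r₃ → ℂ :=
  G₃₁ *ᵥ x₁ + G₃₂ *ᵥ x₂ + z₃

/-- `min {I(X₁, X₂; Y₃), I(X₁; Y₂, Y₃ | X₂)}` for the input law `μ` of `(X₁, X₂)`. -/
def cutsetRate (G₂₁ : Matrix (Fin r₂) (Fin t₁) ℂ) (G₃₁ : Matrix (Fin r₃) (Fin t₁) ℂ)
    (G₃₂ : Matrix (Fin r₃) (Fin t₂) ℂ)
    (μ : ProbabilityMeasure ((Fin t₁ → ℂ) × (Fin t₂ → ℂ))) : ℝ≥0∞ :=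
  let Ω := ((Fin t₁ → ℂ) × (Fin t₂ → ℂ)) × (Fin r₂ → ℂ) × (Fin r₃ → ℂ)
  let X₁ : Ω → Fin t₁ → ℂ := fun ω => ω.1.1
  let X₂ : Ω → Fin t₂ → ℂ := fun ω => ω.1.2
  let Y₂ : Ω → Fin r₂ → ℂ := fun ω => outputY₂ G₂₁ (X₁ ω) ω.2.1
  let Y₃ : Ω → Fin r₃ → ℂ := fun ω => outputY₃ G₃₁ G₃₂ (X₁ ω) (X₂ ω) ω.2.2
  min (mutualInfo (jointLaw r₂ r₃ μ) (fun ω => (X₁ ω, X₂ ω)) Y₃)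
    (condMutualInfo (jointLaw r₂ r₃ μ) X₁ (fun ω => (Y₂ ω, Y₃ ω)) X₂)

/-- The cutset bound `R_CS`, in bits: the supremum of `cutsetRate` over all joint laws of
`(X₁, X₂)` that satisfy both power constraints. -/
def cutsetBound (G₂₁ : Matrix (Fin r₂) (Fin t₁) ℂ) (G₃₁ : Matrix (Fin r₃) (Fin t₁) ℂ)
    (G₃₂ : Matrix (Fin r₃) (Fin t₂) ℂ) (P : ℝ) : ℝ≥0∞ :=
  ⨆ (μ : ProbabilityMeasure ((Fin t₁ → ℂ) × (Fin t₂ → ℂ)))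
    (_ : PowerConstraint P μ (fun e => e.1)) (_ : PowerConstraint P μ (fun e => e.2)),
    cutsetRate G₂₁ G₃₁ G₃₂ μ

/-- `min {I(X₁, X₂; Y₃), I(U; Y₂ | X₂) + I(X₁; Y₃ | X₂, U)}` for the law `μ` of `(U, X₁, X₂)`,
where the auxiliary random vector `U` takes values in `ℂ ^ d`. -/
def pdfRate {d : ℕ} (G₂₁ : Matrix (Fin r₂) (Fin t₁) ℂ) (G₃₁ : Matrix (Fin r₃) (Fin t₁) ℂ)
    (G₃₂ : Matrix (Fin r₃) (Fin t₂) ℂ)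
    (μ : ProbabilityMeasure ((Fin d → ℂ) × (Fin t₁ → ℂ) × (Fin t₂ → ℂ))) : ℝ≥0∞ :=
  let Ω := ((Fin d → ℂ) × (Fin t₁ → ℂ) × (Fin t₂ → ℂ)) × (Fin r₂ → ℂ) × (Fin r₃ → ℂ)
  let U : Ω → Fin d → ℂ := fun ω => ω.1.1
  let X₁ : Ω → Fin t₁ → ℂ := fun ω => ω.1.2.1
  let X₂ : Ω → Fin t₂ → ℂ := fun ω => ω.1.2.2
  let Y₂ : Ω → Fin r₂ → ℂ := fun ω => outputY₂ G₂₁ (X₁ ω) ω.2.1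
  let Y₃ : Ω → Fin r₃ → ℂ := fun ω => outputY₃ G₃₁ G₃₂ (X₁ ω) (X₂ ω) ω.2.2
  min (mutualInfo (jointLaw r₂ r₃ μ) (fun ω => (X₁ ω, X₂ ω)) Y₃)
    (condMutualInfo (jointLaw r₂ r₃ μ) U Y₂ X₂ +
      condMutualInfo (jointLaw r₂ r₃ μ) X₁ Y₃ (fun ω => (X₂ ω, U ω)))

/-- The partial decode–forward lower bound `R_PDF`, in bits: the supremum of `pdfRate` over all
joint laws of `(U, X₁, X₂)`, the dimension `d` of `U` being arbitrary, that satisfy both power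
constraints. -/
def pdfBound (G₂₁ : Matrix (Fin r₂) (Fin t₁) ℂ) (G₃₁ : Matrix (Fin r₃) (Fin t₁) ℂ)
    (G₃₂ : Matrix (Fin r₃) (Fin t₂) ℂ) (P : ℝ) : ℝ≥0∞ :=
  ⨆ (d : ℕ) (μ : ProbabilityMeasure ((Fin d → ℂ) × (Fin t₁ → ℂ) × (Fin t₂ → ℂ)))
    (_ : PowerConstraint P μ (fun e => e.2.1)) (_ : PowerConstraint P μ (fun e => e.2.2)),
    pdfRate G₂₁ G₃₁ G₃₂ μ

end MIMORelay

end

/-! Partial decode–forward nearly attains the cutset bound once `U` is a copy of the relay output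
with fresh noise, `U = G₂₁ X₁ + Z₂'` (`relayCopyLaw`). The law of `(X₁, X₂)` is unchanged, so the
power constraints and `I(X₁, X₂; Y₃)` are the same on both sides. By the chain rule `I(X₁; Y₂, Y₃ |
X₂) = I(X₁; Y₂ | X₂) + I(X₁; Y₃ | X₂, Y₂)`, and the last term equals `I(X₁; Y₃ | X₂, U)`, because
`(X₁, X₂, U, Y₃)` and `(X₁, X₂, Y₂, Y₃)` have the same law. What remains is to bound `I(X₁; Y₂ | X₂)
- I(U; Y₂ | X₂)` by the rank `k` of `G₂₁`, which is at most `min t₁ r₂`.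

Differential entropies are avoided: every output is measured by its relative entropy to the noise
law, conditionally on side information (`condRelEntropy`), and `condMutualInfo_mul_log_two_add`
makes mutual information a difference of two such quantities. Given `(X₁, X₂)`, the relative entropy
of `Y₂` is at most the signal power `E ‖G₂₁ X₁‖²` (`condRelEntropy_add_le`). Given `(X₂, U)`, it is
at least that power minus `k log 2` (`ofReal_sub_le_condRelEntropy`). This is Donsker–Varadhan
tested on a Gaussian density of doubled variance on the column space of `G₂₁`: there `Y₂ - U` is a
difference of two independent noises, and each of the `k` complex dimensions costs one factor of
two, that is, one bit.

Finiteness comes from the power constraints, which bound `I(X₁, X₂; Y₃)` uniformly over all input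
laws. Finiteness of the cutset bound then follows from the comparison. -/

noncomputable section

namespace MIMORelay

/-! ### Relative entropy: variational bound, chain rules and mutual information. -/

section RelativeEntropy

variable {Ω Ω' α β γ δ : Type*} [MeasurableSpace Ω] [MeasurableSpace Ω'] [MeasurableSpace α]
  [MeasurableSpace β] [MeasurableSpace γ] [MeasurableSpace δ]

/-- The relative entropy is invariant under a measurable map with a measurable left inverse. -/
lemma klDiv_map_of_leftInverse (μ ν : Measure α) [IsFiniteMeasure μ] [IsFiniteMeasure ν]
    {f : α → β} {g : β → α} (hf : Measurable f) (hg : Measurable g)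
    (hgf : Function.LeftInverse g f) : klDiv (μ.map f) (ν.map f) = klDiv μ ν := by
  refine le_antisymm (klDiv_map_le μ ν hf) ?_
  have h := klDiv_map_le (μ.map f) (ν.map f) hg
  rwa [Measure.map_map hg hf, Measure.map_map hg hf, hgf.comp_eq_id, Measure.map_id,
    Measure.map_id] at h

/-- Associativity of the product of measures. -/
lemma map_prod_assoc (μ : Measure α) (ν : Measure β) (ρ : Measure γ) [SFinite μ] [SFinite ν]
    [SFinite ρ] :
    ((μ.prod ν).prod ρ).map (fun p : (α × β) × γ => (p.1.1, p.1.2, p.2))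
      = μ.prod (ν.prod ρ) :=
  (measurePreserving_prodAssoc μ ν ρ).map_eq

/-- The Donsker–Varadhan lower bound for the relative entropy. -/
lemma ofReal_integral_le_klDiv (μ ν : Measure α) [IsProbabilityMeasure μ] [IsProbabilityMeasure ν]
    {f : α → ℝ} (hf : Measurable f) (hfμ : Integrable f μ)
    (hfν : ∫⁻ x, ENNReal.ofReal (Real.exp (f x)) ∂ν ≤ 1) :
    ENNReal.ofReal (∫ x, f x ∂μ) ≤ klDiv μ ν := by
  by_cases htop : klDiv μ ν = ∞
  · simp [htop]
  obtain ⟨hac, hllr⟩ := klDiv_ne_top_iff.1 htop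
  have hexp : Integrable (fun x => Real.exp (f x)) ν := by
    refine ⟨hf.exp.aestronglyMeasurable, ?_⟩
    rw [hasFiniteIntegral_iff_ofReal (.of_forall fun x => (Real.exp_pos _).le)]
    exact hfν.trans_lt ENNReal.one_lt_top
  have hle : ∫ x, Real.exp (f x) ∂ν ≤ 1 := by
    rw [integral_eq_lintegral_of_nonneg_ae (.of_forall fun x => (Real.exp_pos _).le)
      hf.exp.aestronglyMeasurable]
    exact ENNReal.toReal_mono ENNReal.one_ne_top hfν
  -- The bound is nonnegativity of the relative entropy of `μ` with respect to the tilted measure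
  -- `e^f ν / ∫ e^f dν`; the logarithm of the normalizer is at most `0` and may be dropped.
  have : IsProbabilityMeasure (ν.tilted f) := isProbabilityMeasure_tilted hexp
  have hnn := integral_llr_add_sub_measure_univ_nonneg
    (hac.trans (absolutelyContinuous_tilted hexp)) (integrable_llr_tilted_right hac hfμ hllr hexp)
  rw [integral_llr_tilted_right hac hfμ hexp hllr] at hnn
  have hlog : Real.log (∫ x, Real.exp (f x) ∂ν) ≤ 0 :=
    Real.log_nonpos (integral_nonneg fun x => (Real.exp_pos _).le) hle
  rw [klDiv_of_ac_of_integrable hac hllr]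
  refine ENNReal.ofReal_le_ofReal ?_
  simp only [probReal_univ] at hnn ⊢
  linarith

/-- The relative entropy of the joint law of `(Z, Y)` with respect to the product of the law of
`Z` and of the reference measure `lam`. -/
def condRelEntropy (ν : Measure Ω) (Z : Ω → γ) (Y : Ω → β) (lam : Measure β) : ℝ≥0∞ :=
  klDiv (ν.map fun ω => (Z ω, Y ω)) ((ν.map Z).prod lam)

lemma condRelEntropy_comp_measurePreserving {ν' : Measure Ω'} {ν : Measure Ω} {π : Ω' → Ω}
    (hπ : MeasurePreserving π ν' ν) {Z : Ω → γ} {Y : Ω → β} (hZ : Measurable Z)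
    (hY : Measurable Y) (lam : Measure β) :
    condRelEntropy ν' (fun ω => Z (π ω)) (fun ω => Y (π ω)) lam = condRelEntropy ν Z Y lam := by
  rw [condRelEntropy, condRelEntropy, ← hπ.map_eq,
    Measure.map_map (by fun_prop) hπ.measurable, Measure.map_map hZ hπ.measurable]
  rfl

lemma condRelEntropy_of_leftInverse (ν : Measure Ω) [IsFiniteMeasure ν] (lam : Measure β)
    [IsFiniteMeasure lam] {Z : Ω → γ} {Y : Ω → β} (hZ : Measurable Z) (hY : Measurable Y)
    {f : γ → δ} {g : δ → γ} (hf : Measurable f) (hg : Measurable g)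
    (hgf : Function.LeftInverse g f) :
    condRelEntropy ν (fun ω => f (Z ω)) Y lam = condRelEntropy ν Z Y lam := by
  have h := klDiv_map_of_leftInverse (ν.map fun ω => (Z ω, Y ω)) ((ν.map Z).prod lam)
    (f := Prod.map f id) (g := Prod.map g id) (by fun_prop) (by fun_prop)
    (fun p => Prod.ext (hgf p.1) rfl)
  rw [condRelEntropy, condRelEntropy, ← h, Measure.map_map (by fun_prop) (by fun_prop),
    ← Measure.map_prod_map _ _ hf measurable_id, Measure.map_id, Measure.map_map hf hZ]
  rfl

/-- The chain rule for the relative entropy of a pair of outputs. -/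
lemma condRelEntropy_prod [StandardBorelSpace α] [Nonempty α] (ν : Measure Ω) [IsFiniteMeasure ν]
    (lam : Measure β) (κ : Measure α) [IsProbabilityMeasure lam] [IsProbabilityMeasure κ]
    {Z : Ω → γ} {Y : Ω → β} {W : Ω → α} (hZ : Measurable Z) (hY : Measurable Y)
    (hW : Measurable W) :
    condRelEntropy ν Z (fun ω => (Y ω, W ω)) (lam.prod κ)
      = condRelEntropy ν Z Y lam + condRelEntropy ν (fun ω => (Z ω, Y ω)) W κ := by
  have hZY : Measurable fun ω => (Z ω, Y ω) := by fun_prop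
  have h := klDiv_compProd_eq_add (ν.map fun ω => (Z ω, Y ω)) ((ν.map Z).prod lam)
    (condDistrib W (fun ω => (Z ω, Y ω)) ν) (Kernel.const _ κ)
  simp only [Measure.compProd_const, compProd_map_condDistrib hW.aemeasurable] at h
  rw [← klDiv_map_of_leftInverse _ _ (f := fun p : (γ × β) × α => (p.1.1, p.1.2, p.2))
    (g := fun p => ((p.1, p.2.1), p.2.2)) (by fun_prop) (by fun_prop) (fun _ => rfl),
    Measure.map_map (by fun_prop) (by fun_prop), map_prod_assoc] at h
  exact h

/-- The relative entropy of the output given the side information and the input is the sum of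
the conditional mutual information and of the relative entropy given the side information. -/
lemma condMutualInfo_mul_log_two_add [StandardBorelSpace α] [Nonempty α] [StandardBorelSpace β]
    [Nonempty β] (ν : Measure Ω) [IsFiniteMeasure ν] (lam : Measure β) [IsProbabilityMeasure lam]
    {Z : Ω → γ} {X : Ω → α} {Y : Ω → β} (hZ : Measurable Z) (hX : Measurable X)
    (hY : Measurable Y) :
    condMutualInfo ν X Y Z * ENNReal.ofReal (Real.log 2) + condRelEntropy ν Z Y lam
      = condRelEntropy ν (fun ω => (Z ω, X ω)) Y lam := by
  have h2 : ENNReal.ofReal (Real.log 2) ≠ 0 := by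
    simpa using Real.log_pos one_lt_two
  rw [condMutualInfo, ENNReal.div_mul_cancel h2 ENNReal.ofReal_ne_top, add_comm]
  have hZY : Measurable fun ω => (Z ω, Y ω) := by fun_prop
  -- `K` draws `X` from `Z` alone, ignoring `Y`. Under `P_Z × lam` this makes `(Z, X)` independent
  -- of the output; under `P_{Z,Y}` it gives the conditionally independent law. The chain rule for
  -- the joint law of `((Z, Y), X)` is then the claim, up to reordering coordinates.
  let K : Kernel (γ × β) α := (condDistrib X Z ν).comap Prod.fst measurable_fst
  have h := klDiv_compProd_eq_add (ν.map fun ω => (Z ω, Y ω)) ((ν.map Z).prod lam)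
    (condDistrib X (fun ω => (Z ω, Y ω)) ν) K
  rw [compProd_map_condDistrib hX.aemeasurable] at h
  let r : (γ × α) × β → (γ × β) × α := fun p => ((p.1.1, p.2), p.1.2)
  let s : γ × α × β → (γ × β) × α := fun p => ((p.1, p.2.2), p.2.1)
  have h1 : ((ν.map Z).prod lam) ⊗ₘ K = ((ν.map fun ω => (Z ω, X ω)).prod lam).map r := by
    rw [← compProd_map_condDistrib hX.aemeasurable]
    refine Measure.ext_of_lintegral _ fun f hf => ?_
    rw [Measure.lintegral_compProd hf,
      lintegral_prod _ hf.lintegral_kernel_prod_right'.aemeasurable,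
      lintegral_map hf (by fun_prop), lintegral_prod _ (by fun_prop),
      Measure.lintegral_compProd (by fun_prop)]
    refine lintegral_congr fun z => ?_
    rw [lintegral_lintegral_swap (by fun_prop)]
    rfl
  have h3 : (ν.map fun ω => (Z ω, Y ω)) ⊗ₘ K
      = ((ν.map Z) ⊗ₘ (condDistrib X Z ν ×ₖ condDistrib Y Z ν)).map s := by
    rw [← compProd_map_condDistrib hY.aemeasurable]
    refine Measure.ext_of_lintegral _ fun f hf => ?_
    rw [Measure.lintegral_compProd hf, Measure.lintegral_compProd (by fun_prop),
      lintegral_map hf (by fun_prop), Measure.lintegral_compProd (by fun_prop)]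
    refine lintegral_congr fun z => ?_
    rw [Kernel.prod_apply, lintegral_prod_symm _ (by fun_prop)]
    rfl
  have h4 : (ν.map fun ω => ((Z ω, Y ω), X ω)) = (ν.map fun ω => ((Z ω, X ω), Y ω)).map r := by
    rw [Measure.map_map (by fun_prop) (by fun_prop)]; rfl
  have h5 : (ν.map fun ω => ((Z ω, Y ω), X ω)) = (ν.map fun ω => (Z ω, (X ω, Y ω))).map s := by
    rw [Measure.map_map (by fun_prop) (by fun_prop)]; rfl
  rw [h1, h3] at h
  nth_rw 1 [h4] at h
  rw [h5, klDiv_map_of_leftInverse _ _ (f := r) (g := fun p => ((p.1.1, p.2), p.1.2))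
    (by fun_prop) (by fun_prop) (fun _ => rfl), klDiv_map_of_leftInverse _ _ (f := s)
    (g := fun p => (p.1.1, p.2, p.1.2)) (by fun_prop) (by fun_prop) (fun _ => rfl)] at h
  exact h.symm

/-- The chain rule with `Y` taken first splits the right side into the mutual information and the
relative entropy of the law of `Y` to `lam`; the latter is nonnegative. -/
lemma mutualInfo_mul_log_two_le [StandardBorelSpace α] [Nonempty α] (ν : Measure Ω)
    [IsProbabilityMeasure ν] (lam : Measure β) [IsProbabilityMeasure lam] {X : Ω → α} {Y : Ω → β}
    (hX : Measurable X) (hY : Measurable Y) :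
    mutualInfo ν X Y * ENNReal.ofReal (Real.log 2) ≤ condRelEntropy ν X Y lam := by
  have h2 : ENNReal.ofReal (Real.log 2) ≠ 0 := by
    simpa using Real.log_pos one_lt_two
  rw [mutualInfo, ENNReal.div_mul_cancel h2 ENNReal.ofReal_ne_top]
  have := Measure.isProbabilityMeasure_map (μ := ν) hX.aemeasurable
  have h := klDiv_compProd_eq_add (ν.map Y) lam (condDistrib X Y ν) (Kernel.const _ (ν.map X))
  simp only [Measure.compProd_const, compProd_map_condDistrib hX.aemeasurable] at h
  rw [condRelEntropy, ← klDiv_map_of_leftInverse _ _ (f := Prod.swap) (g := Prod.swap)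
    measurable_swap measurable_swap Prod.swap_swap, ← klDiv_map_of_leftInverse
    (ν.map fun ω => (X ω, Y ω)) ((ν.map X).prod lam) (f := Prod.swap) (g := Prod.swap)
    measurable_swap measurable_swap Prod.swap_swap, Measure.prod_swap, Measure.prod_swap,
    Measure.map_map measurable_swap (by fun_prop)]
  exact h ▸ le_add_self

lemma mutualInfo_comp_measurePreserving {ν' : Measure Ω'} {ν : Measure Ω} {π : Ω' → Ω}
    (hπ : MeasurePreserving π ν' ν) {X : Ω → α} {Y : Ω → β} (hX : Measurable X)
    (hY : Measurable Y) :
    mutualInfo ν' (fun ω => X (π ω)) (fun ω => Y (π ω)) = mutualInfo ν X Y := by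
  rw [mutualInfo, mutualInfo, ← hπ.map_eq, Measure.map_map (by fun_prop) hπ.measurable,
    Measure.map_map hX hπ.measurable, Measure.map_map hY hπ.measurable]
  rfl

end RelativeEntropy

/-! ### Hermitian algebra on `ℂ ^ r`, Gaussian shifts, exponential integrals and moments. -/

section ComplexGaussian

variable {r k : ℕ}

/-- The squared Euclidean norm on `ℂ ^ r`. -/
def normSq (x : Fin r → ℂ) : ℝ := ∑ i, ‖x i‖ ^ 2

/-- The real part of the Hermitian inner product on `ℂ ^ r`. -/
def reInner (x y : Fin r → ℂ) : ℝ := (star x ⬝ᵥ y).re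

lemma reInner_eq_sum (x y : Fin r → ℂ) : reInner x y = ∑ i, (star (x i) * y i).re := by
  simp [reInner, dotProduct]

lemma reInner_self (x : Fin r → ℂ) : reInner x x = normSq x := by
  simp [reInner_eq_sum, normSq, ← Complex.normSq_eq_conj_mul_self, Complex.normSq_eq_norm_sq,
    -Complex.ofReal_pow]

lemma normSq_nonneg (x : Fin r → ℂ) : 0 ≤ normSq x :=
  Finset.sum_nonneg fun _ _ => by positivity

lemma reInner_comm (x y : Fin r → ℂ) : reInner x y = reInner y x := by
  simp only [reInner_eq_sum]
  refine Finset.sum_congr rfl fun i _ => ?_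
  simp [mul_comm]

lemma reInner_add_left (x y z : Fin r → ℂ) : reInner (x + y) z = reInner x z + reInner y z := by
  simp [reInner, add_dotProduct]

lemma reInner_add_right (x y z : Fin r → ℂ) : reInner x (y + z) = reInner x y + reInner x z := by
  simp [reInner, dotProduct_add]

lemma reInner_smul_right (c : ℝ) (x y : Fin r → ℂ) :
    reInner x ((c : ℂ) • y) = c * reInner x y := by
  simp [reInner, dotProduct_smul]

lemma reInner_smul_left (c : ℝ) (x y : Fin r → ℂ) :
    reInner ((c : ℂ) • x) y = c * reInner x y := by
  rw [reInner_comm, reInner_smul_right, reInner_comm]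

lemma normSq_add (x y : Fin r → ℂ) :
    normSq (x + y) = normSq x + 2 * reInner x y + normSq y := by
  rw [← reInner_self, reInner_add_left, reInner_add_right, reInner_add_right, reInner_self,
    reInner_self, reInner_comm y x]
  ring

lemma normSq_smul (c : ℝ) (x : Fin r → ℂ) : normSq ((c : ℂ) • x) = c ^ 2 * normSq x := by
  simp [normSq, Finset.mul_sum, mul_pow]

lemma normSq_sub (x y : Fin r → ℂ) :
    normSq (x - y) = normSq x - 2 * reInner x y + normSq y := by
  have h := normSq_add x (((-1 : ℝ) : ℂ) • y)
  rw [reInner_smul_right, normSq_smul] at h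
  have h2 : x - y = x + ((-1 : ℝ) : ℂ) • y := by simp [sub_eq_add_neg]
  rw [h2, h]
  ring

lemma reInner_conjTranspose_mulVec (V : Matrix (Fin r) (Fin k) ℂ) (y : Fin r → ℂ)
    (c : Fin k → ℂ) : reInner (Vᴴ *ᵥ y) c = reInner y (V *ᵥ c) := by
  simp [reInner, Matrix.star_mulVec, Matrix.dotProduct_mulVec]

lemma normSq_mulVec (V : Matrix (Fin r) (Fin k) ℂ) (hV : Vᴴ * V = 1) (c : Fin k → ℂ) :
    normSq (V *ᵥ c) = normSq c := by
  rw [← reInner_self, ← reInner_conjTranspose_mulVec, Matrix.mulVec_mulVec, hV,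
    Matrix.one_mulVec, reInner_self]

@[fun_prop]
lemma continuous_normSq : Continuous (normSq (r := r)) := by
  unfold normSq; fun_prop

@[fun_prop]
lemma measurable_normSq : Measurable (normSq (r := r)) := continuous_normSq.measurable

@[fun_prop]
lemma _root_.Measurable.reInner {α : Type*} [MeasurableSpace α] {f g : α → Fin r → ℂ}
    (hf : Measurable f) (hg : Measurable g) : Measurable fun a => MIMORelay.reInner (f a) (g a) := by
  simp only [reInner_eq_sum]
  fun_prop

@[fun_prop]
lemma _root_.Measurable.matrix_mulVec {α : Type*} [MeasurableSpace α] {f : α → Fin k → ℂ}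
    (hf : Measurable f) (V : Matrix (Fin r) (Fin k) ℂ) : Measurable fun a => V *ᵥ f a :=
  (Continuous.matrix_mulVec continuous_const continuous_id).measurable.comp hf

lemma gaussianReal_eq_withDensity (c : ℝ) :
    gaussianReal c (1 / 2) = (gaussianReal 0 (1 / 2)).withDensity
      fun x => ENNReal.ofReal (Real.exp (2 * c * x - c ^ 2)) := by
  have hv : (1 / 2 : NNReal) ≠ 0 := by norm_num
  rw [gaussianReal_of_var_ne_zero _ hv, gaussianReal_of_var_ne_zero _ hv,
    ← withDensity_mul _ (measurable_gaussianPDF _ _) (by fun_prop)]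
  congr 1
  ext x
  simp only [Pi.mul_apply, gaussianPDF, gaussianPDFReal]
  rw [← ENNReal.ofReal_mul (by positivity), mul_assoc _ (Real.exp _), ← Real.exp_add]
  congr 3
  push_cast
  ring

/-- Completing the square turns the density of variance `1 / 2` into one of variance `1` and mean
`c`; the ratio of normalizing constants is `√2`. Two real coordinates per complex dimension give the
factor `2` behind the one-bit loss. -/
lemma lintegral_exp_sq_gaussianReal (c : ℝ) :
    ∫⁻ x, ENNReal.ofReal (Real.exp (x ^ 2 / 2 + c * x)) ∂(gaussianReal 0 (1 / 2))
      = ENNReal.ofReal (√2 * Real.exp (c ^ 2 / 2)) := by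
  have hv : (1 / 2 : NNReal) ≠ 0 := by norm_num
  rw [gaussianReal_of_var_ne_zero _ hv,
    lintegral_withDensity_eq_lintegral_mul _ (measurable_gaussianPDF _ _) (by fun_prop)]
  have h : ∀ x, (gaussianPDF 0 (1 / 2) * fun x => ENNReal.ofReal (Real.exp (x ^ 2 / 2 + c * x))) x
      = ENNReal.ofReal (√2 * Real.exp (c ^ 2 / 2)) * gaussianPDF c 1 x := by
    intro x
    simp only [Pi.mul_apply, gaussianPDF, gaussianPDFReal]
    rw [← ENNReal.ofReal_mul (by positivity), ← ENNReal.ofReal_mul (by positivity)]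
    congr 1
    have h1 : √(2 * Real.pi * (1 : NNReal)) = √2 * √(2 * Real.pi * (1 / 2 : NNReal)) := by
      rw [← Real.sqrt_mul (by norm_num)]
      congr 1
      push_cast
      ring
    have h2 : √2 * (√(2 * Real.pi * (1 : NNReal)))⁻¹ = (√(2 * Real.pi * (1 / 2 : NNReal)))⁻¹ := by
      rw [h1, mul_inv, ← mul_assoc, mul_inv_cancel₀ (by positivity), one_mul]
    have h3 : Real.exp (-(x - 0) ^ 2 / (2 * (1 / 2 : NNReal))) * Real.exp (x ^ 2 / 2 + c * x)
        = Real.exp (c ^ 2 / 2) * Real.exp (-(x - c) ^ 2 / (2 * (1 : NNReal))) := by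
      rw [← Real.exp_add, ← Real.exp_add]
      congr 1
      push_cast
      ring
    rw [mul_assoc, h3, ← h2]
    ring
  simp only [h]
  rw [lintegral_const_mul _ (measurable_gaussianPDF _ _), lintegral_gaussianPDF_eq_one _ one_ne_zero,
    mul_one]

lemma lintegral_complexGaussian {f : ℂ → ℝ≥0∞} (hf : Measurable f) :
    ∫⁻ z, f z ∂complexGaussian
      = ∫⁻ x, ∫⁻ y, f ⟨x, y⟩ ∂(gaussianReal 0 (1 / 2)) ∂(gaussianReal 0 (1 / 2)) := by
  rw [complexGaussian, lintegral_map hf (by fun_prop), lintegral_prod _ (by fun_prop)]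
  rfl

/-- The law of a shifted complex Gaussian variable has an exponential density. -/
lemma map_add_complexGaussian (c : ℂ) :
    complexGaussian.map (fun z => c + z) = complexGaussian.withDensity
      fun z => ENNReal.ofReal (Real.exp (2 * (star c * z).re - ‖c‖ ^ 2)) := by
  have shift (a : ℝ) {f : ℝ → ℝ≥0∞} (hf : Measurable f) :
      ∫⁻ x, f (a + x) ∂(gaussianReal 0 (1 / 2))
        = ∫⁻ x, ENNReal.ofReal (Real.exp (2 * a * x - a ^ 2)) * f x ∂(gaussianReal 0 (1 / 2)) := by
    rw [← lintegral_map (g := fun x => a + x) hf (by fun_prop), gaussianReal_map_const_add,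
      zero_add, gaussianReal_eq_withDensity,
      lintegral_withDensity_eq_lintegral_mul _ (by fun_prop) hf]
    rfl
  refine Measure.ext_of_lintegral _ fun f hf => ?_
  have hmk : Measurable fun p : ℝ × ℝ => (⟨p.1, p.2⟩ : ℂ) :=
    Complex.measurableEquivRealProd.symm.measurable
  have hfm : Measurable fun p : ℝ × ℝ => f ⟨p.1, p.2⟩ := hf.comp hmk
  have hfy (x : ℝ) : Measurable fun y : ℝ => f ⟨x, y⟩ := hfm.comp measurable_prodMk_left
  rw [lintegral_map hf (by fun_prop), lintegral_complexGaussian (by fun_prop),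
    lintegral_withDensity_eq_lintegral_mul _ (by fun_prop) hf,
    lintegral_complexGaussian (by fun_prop)]
  have h1 (x : ℝ) : ∫⁻ y, f (c + ⟨x, y⟩) ∂(gaussianReal 0 (1 / 2))
      = ∫⁻ y, ENNReal.ofReal (Real.exp (2 * c.im * y - c.im ^ 2)) * f ⟨c.re + x, y⟩
        ∂(gaussianReal 0 (1 / 2)) :=
    shift c.im (hfy (c.re + x))
  simp only [h1]
  rw [shift c.re (f := fun x => ∫⁻ y, ENNReal.ofReal (Real.exp (2 * c.im * y - c.im ^ 2))
    * f ⟨x, y⟩ ∂(gaussianReal 0 (1 / 2)))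
    (Measurable.lintegral_prod_right' (f := fun p : ℝ × ℝ =>
      ENNReal.ofReal (Real.exp (2 * c.im * p.2 - c.im ^ 2)) * f ⟨p.1, p.2⟩) (by fun_prop))]
  refine lintegral_congr fun x => ?_
  rw [← lintegral_const_mul _ (by have := hfy x; fun_prop)]
  refine lintegral_congr fun y => ?_
  rw [← mul_assoc, ← ENNReal.ofReal_mul (by positivity), ← Real.exp_add, Pi.mul_apply]
  congr 3
  rw [← Complex.normSq_eq_norm_sq, Complex.normSq_apply]
  simp
  ring

lemma lintegral_exp_normSq_complexGaussian (v : ℂ) :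
    ∫⁻ s, ENNReal.ofReal (Real.exp (‖s‖ ^ 2 / 2 + (star s * v).re / √2)) ∂complexGaussian
      = ENNReal.ofReal (2 * Real.exp (‖v‖ ^ 2 / 4)) := by
  rw [lintegral_complexGaussian (by fun_prop)]
  have h (x y : ℝ) : ENNReal.ofReal (Real.exp (‖(⟨x, y⟩ : ℂ)‖ ^ 2 / 2
      + (star (⟨x, y⟩ : ℂ) * v).re / √2))
      = ENNReal.ofReal (Real.exp (x ^ 2 / 2 + v.re / √2 * x))
        * ENNReal.ofReal (Real.exp (y ^ 2 / 2 + v.im / √2 * y)) := by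
    rw [← ENNReal.ofReal_mul (by positivity), ← Real.exp_add]
    congr 2
    rw [← Complex.normSq_eq_norm_sq, Complex.normSq_apply]
    simp
    ring
  simp only [h]
  rw [lintegral_lintegral_mul (by fun_prop) (by fun_prop), lintegral_exp_sq_gaussianReal,
    lintegral_exp_sq_gaussianReal, ← ENNReal.ofReal_mul (by positivity)]
  congr 1
  rw [mul_mul_mul_comm, ← Real.exp_add, Real.mul_self_sqrt (by norm_num),
    ← Complex.normSq_eq_norm_sq, Complex.normSq_apply, div_pow, div_pow, Real.sq_sqrt (by norm_num)]
  congr 2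
  ring

lemma lintegral_prod_complexGaussianVec {f : Fin r → ℂ → ℝ≥0∞} (hf : ∀ i, Measurable (f i)) :
    ∫⁻ z, ∏ i, f i (z i) ∂(complexGaussianVec r) = ∏ i, ∫⁻ z, f i z ∂complexGaussian := by
  have hind : iIndepFun (fun i (z : Fin r → ℂ) => f i (z i)) (complexGaussianVec r) :=
    iIndepFun_pi fun i => (hf i).aemeasurable
  rw [lintegral_prod_eq_prod_lintegral_of_indepFun _ _ hind (by fun_prop)]
  refine Finset.prod_congr rfl fun i _ => ?_
  exact (measurePreserving_eval (fun _ : Fin r => complexGaussian) i).lintegral_comp (hf i)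

/-- The law of a shifted complex Gaussian vector has an exponential density. -/
lemma map_add_complexGaussianVec (m : Fin r → ℂ) :
    (complexGaussianVec r).map (fun z => m + z) = (complexGaussianVec r).withDensity
      fun z => ENNReal.ofReal (Real.exp (2 * reInner m z - normSq m)) := by
  have h1 : (complexGaussianVec r).map (fun z => m + z)
      = Measure.pi fun i => complexGaussian.map fun z => m i + z :=
    Measure.pi_map_pi (f := fun i z => m i + z) fun i => by fun_prop
  have (i : Fin r) : IsProbabilityMeasure (complexGaussian.map fun z => m i + z) :=
    Measure.isProbabilityMeasure_map (by fun_prop)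
  rw [h1]
  refine Measure.pi_eq fun s hs => ?_
  rw [withDensity_apply _ (.univ_pi hs), ← lintegral_indicator (.univ_pi hs)]
  have h2 (z : Fin r → ℂ) : (Set.univ.pi s).indicator
      (fun z => ENNReal.ofReal (Real.exp (2 * reInner m z - normSq m))) z
      = ∏ i, (s i).indicator
        (fun z => ENNReal.ofReal (Real.exp (2 * (star (m i) * z).re - ‖m i‖ ^ 2))) (z i) := by
    by_cases hz : z ∈ Set.univ.pi s
    · rw [Set.indicator_of_mem hz, Finset.prod_congr rfl fun i _ =>
        Set.indicator_of_mem (hz i (Set.mem_univ i)) _,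
        ← ENNReal.ofReal_prod_of_nonneg fun _ _ => (Real.exp_pos _).le, ← Real.exp_sum,
        reInner_eq_sum, normSq, Finset.sum_sub_distrib, Finset.mul_sum]
    · rw [Set.indicator_of_notMem hz]
      obtain ⟨i, hi⟩ : ∃ i, z i ∉ s i := by simpa using hz
      exact (Finset.prod_eq_zero (Finset.mem_univ i) (Set.indicator_of_notMem hi _)).symm
  simp only [h2]
  rw [lintegral_prod_complexGaussianVec fun i => Measurable.indicator (by fun_prop) (hs i)]
  refine Finset.prod_congr rfl fun i _ => ?_
  rw [lintegral_indicator (hs i), map_add_complexGaussian, withDensity_apply _ (hs i)]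

/-- The moment generating function of a complex Gaussian vector. -/
lemma lintegral_exp_reInner (m : Fin r → ℂ) :
    ∫⁻ z, ENNReal.ofReal (Real.exp (2 * reInner z m)) ∂(complexGaussianVec r)
      = ENNReal.ofReal (Real.exp (normSq m)) := by
  -- This integrand is the density of a shifted Gaussian law, so its integral needs no computation.
  have h : ∫⁻ z, ENNReal.ofReal (Real.exp (2 * reInner m z - normSq m)) ∂(complexGaussianVec r)
      = 1 := by
    have := Measure.isProbabilityMeasure_map (μ := complexGaussianVec r)
      (f := fun z => m + z) (by fun_prop)
    rw [map_add_complexGaussianVec] at this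
    rw [← setLIntegral_univ, ← withDensity_apply _ .univ, measure_univ]
  calc _ = ∫⁻ z, ENNReal.ofReal (Real.exp (normSq m))
        * ENNReal.ofReal (Real.exp (2 * reInner m z - normSq m)) ∂(complexGaussianVec r) := by
        refine lintegral_congr fun z => ?_
        rw [← ENNReal.ofReal_mul (by positivity), ← Real.exp_add, reInner_comm]
        congr 2
        ring
    _ = _ := by rw [lintegral_const_mul _ (by fun_prop), h, mul_one]

lemma lintegral_exp_normSq_div_two (v : Fin k → ℂ) :
    ∫⁻ s, ENNReal.ofReal (Real.exp (normSq s / 2 + reInner s v / √2)) ∂(complexGaussianVec k)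
      = ENNReal.ofReal (2 ^ k * Real.exp (normSq v / 4)) := by
  have h (s : Fin k → ℂ) : ENNReal.ofReal (Real.exp (normSq s / 2 + reInner s v / √2))
      = ∏ i, ENNReal.ofReal (Real.exp (‖s i‖ ^ 2 / 2 + (star (s i) * v i).re / √2)) := by
    rw [← ENNReal.ofReal_prod_of_nonneg fun _ _ => (Real.exp_pos _).le, ← Real.exp_sum,
      Finset.sum_add_distrib, reInner_eq_sum, normSq, Finset.sum_div, Finset.sum_div]
  simp only [h]
  rw [lintegral_prod_complexGaussianVec
    (f := fun i s => ENNReal.ofReal (Real.exp (‖s‖ ^ 2 / 2 + (star s * v i).re / √2)))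
    fun i => by fun_prop]
  simp only [lintegral_exp_normSq_complexGaussian]
  rw [← ENNReal.ofReal_prod_of_nonneg fun _ _ => by positivity, Finset.prod_mul_distrib,
    ← Real.exp_sum, ← Finset.sum_div]
  simp [normSq]

lemma integrable_norm_sq_complexGaussian : Integrable (fun z => ‖z‖ ^ 2) complexGaussian := by
  have h : Integrable (fun x : ℝ => x ^ 2) (gaussianReal 0 (1 / 2)) :=
    (memLp_id_gaussianReal 2).integrable_sq
  rw [complexGaussian, integrable_map_equiv]
  refine ((h.comp_fst (gaussianReal 0 (1 / 2))).add
    (h.comp_snd (gaussianReal 0 (1 / 2)))).congr (.of_forall fun p => ?_)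
  simp [← Complex.normSq_eq_norm_sq, Complex.normSq_apply, Complex.measurableEquivRealProd_symm_apply]
  ring

lemma integrable_id_complexGaussian : Integrable (fun z => z) complexGaussian := by
  have : MemLp (fun z : ℂ => z) 2 complexGaussian :=
    (memLp_two_iff_integrable_sq_norm (by fun_prop)).2 integrable_norm_sq_complexGaussian
  exact this.integrable one_le_two

lemma integral_id_complexGaussian : ∫ z, z ∂complexGaussian = 0 := by
  have h : Integrable (fun x : ℝ => x) (gaussianReal 0 (1 / 2)) :=
    (memLp_id_gaussianReal 1).integrable le_rfl
  have hint := integrable_id_complexGaussian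
  rw [complexGaussian, integrable_map_equiv] at hint
  replace hint : Integrable (fun p => Complex.measurableEquivRealProd.symm p)
    ((gaussianReal 0 (1 / 2)).prod (gaussianReal 0 (1 / 2))) := hint
  rw [complexGaussian, integral_map_equiv]
  apply Complex.ext
  · rw [← RCLike.re_eq_complex_re, ← integral_re hint]
    exact (integral_fun_fst (fun x : ℝ => x)).trans (by simp)
  · rw [← RCLike.im_eq_complex_im, ← integral_im hint]
    exact (integral_fun_snd (fun x : ℝ => x)).trans (by simp)

lemma integrable_apply_complexGaussianVec (i : Fin r) :
    Integrable (fun z => z i) (complexGaussianVec r) :=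
  (measurePreserving_eval (fun _ : Fin r => complexGaussian) i).integrable_comp_of_integrable
    integrable_id_complexGaussian

lemma integral_apply_complexGaussianVec (i : Fin r) : ∫ z, z i ∂(complexGaussianVec r) = 0 := by
  rw [← integral_id_complexGaussian,
    ← (measurePreserving_eval (fun _ : Fin r => complexGaussian) i).map_eq,
    integral_map (measurable_pi_apply i).aemeasurable (by fun_prop)]
  rfl

lemma integrable_normSq_complexGaussianVec : Integrable normSq (complexGaussianVec r) :=
  integrable_finsetSum _ fun i _ =>
    (measurePreserving_eval (fun _ : Fin r => complexGaussian) i).integrable_comp_of_integrable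
      integrable_norm_sq_complexGaussian

end ComplexGaussian

/-! ### Upper and lower bounds for the relative entropy of a Gaussian channel output. -/

section GaussianBounds

variable {r k t : ℕ} {Ω α γ : Type*} [MeasurableSpace Ω] [MeasurableSpace α] [MeasurableSpace γ]

lemma integrable_apply_of_integrable_normSq {ρ : Measure α} [IsFiniteMeasure ρ]
    {c : α → Fin r → ℂ} (hc : Measurable c) (h : Integrable (fun a => normSq (c a)) ρ) (i : Fin r) :
    Integrable (fun a => c a i) ρ := by
  have : MemLp (fun a => c a i) 2 ρ := by
    refine (memLp_two_iff_integrable_sq_norm (by fun_prop)).2 (h.mono' (by fun_prop) ?_)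
    refine .of_forall fun a => ?_
    rw [Real.norm_of_nonneg (by positivity)]
    exact Finset.single_le_sum (f := fun i => ‖c a i‖ ^ 2) (fun _ _ => by positivity)
      (Finset.mem_univ i)
  exact this.integrable one_le_two

lemma integrable_star_mul_complexGaussianVec {ρ : Measure α} [IsFiniteMeasure ρ]
    {c : α → Fin r → ℂ} (h : ∀ i, Integrable (fun a => c a i) ρ) (i : Fin r) :
    Integrable (fun p : α × (Fin r → ℂ) => star (c p.1 i) * p.2 i)
      (ρ.prod (complexGaussianVec r)) :=
  Integrable.mul_prod (f := fun a => star (c a i))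
    ((Complex.conjCLE : ℂ →L[ℝ] ℂ).integrable_comp (h i)) (integrable_apply_complexGaussianVec i)

lemma integrable_reInner_complexGaussianVec {ρ : Measure α} [IsFiniteMeasure ρ]
    {c : α → Fin r → ℂ} (h : ∀ i, Integrable (fun a => c a i) ρ) :
    Integrable (fun p : α × (Fin r → ℂ) => reInner (c p.1) p.2)
      (ρ.prod (complexGaussianVec r)) := by
  simp only [reInner_eq_sum]
  exact integrable_finsetSum _ fun i _ => (integrable_star_mul_complexGaussianVec h i).re

lemma integral_reInner_complexGaussianVec {ρ : Measure α} [IsFiniteMeasure ρ]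
    {c : α → Fin r → ℂ} (h : ∀ i, Integrable (fun a => c a i) ρ) :
    ∫ p : α × (Fin r → ℂ), reInner (c p.1) p.2 ∂(ρ.prod (complexGaussianVec r)) = 0 := by
  have hre (i : Fin r) : Integrable (fun p : α × (Fin r → ℂ) => (star (c p.1 i) * p.2 i).re)
      (ρ.prod (complexGaussianVec r)) := (integrable_star_mul_complexGaussianVec h i).re
  simp only [reInner_eq_sum]
  rw [integral_finsetSum _ fun i _ => hre i]
  refine Finset.sum_eq_zero fun i _ => ?_
  have h1 := integral_re (integrable_star_mul_complexGaussianVec h i)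
  rw [integral_prod_mul (fun a => star (c a i)) (fun z : Fin r → ℂ => z i),
    integral_apply_complexGaussianVec, mul_zero] at h1
  simpa using h1

/-- The joint law of a variable and of its noisy image, as a density. -/
lemma map_add_prod_complexGaussianVec (ρ : Measure α) [SFinite ρ] {m : α → Fin r → ℂ}
    (hm : Measurable m) :
    (ρ.prod (complexGaussianVec r)).map (fun p => (p.1, m p.1 + p.2))
      = (ρ.prod (complexGaussianVec r)).withDensity
        fun p => ENNReal.ofReal (Real.exp (2 * reInner (m p.1) p.2 - normSq (m p.1))) := by
  refine Measure.ext_of_lintegral _ fun f hf => ?_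
  rw [lintegral_map hf (by fun_prop), lintegral_withDensity_eq_lintegral_mul _ (by fun_prop) hf,
    lintegral_prod _ (by fun_prop), lintegral_prod _ (by fun_prop)]
  refine lintegral_congr fun a => ?_
  have hfa : Measurable fun z => f (a, z) := hf.comp measurable_prodMk_left
  rw [← lintegral_map (g := fun z => m a + z) hfa (by fun_prop), map_add_complexGaussianVec,
    lintegral_withDensity_eq_lintegral_mul _ (by fun_prop) hfa]
  rfl

/-- The relative entropy of a Gaussian channel output with respect to the noise law is at most the
power of the noiseless output. -/
lemma condRelEntropy_add_le (ν : Measure Ω) [IsProbabilityMeasure ν] {A : Ω → α}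
    {N : Ω → Fin r → ℂ} {m : α → Fin r → ℂ} (hA : Measurable A) (hN : Measurable N)
    (hm : Measurable m)
    (hind : ν.map (fun ω => (A ω, N ω)) = (ν.map A).prod (complexGaussianVec r)) :
    condRelEntropy ν A (fun ω => m (A ω) + N ω) (complexGaussianVec r)
      ≤ ∫⁻ ω, ENNReal.ofReal (normSq (m (A ω))) ∂ν := by
  by_cases htop : ∫⁻ ω, ENNReal.ofReal (normSq (m (A ω))) ∂ν = ∞
  · simp [htop]
  have : IsProbabilityMeasure (ν.map A) := Measure.isProbabilityMeasure_map hA.aemeasurable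
  set ρ := ν.map A with hρ
  rw [← lintegral_map (f := fun a => ENNReal.ofReal (normSq (m a))) (by fun_prop) hA, ← hρ]
    at htop ⊢
  have hsq : Integrable (fun a => normSq (m a)) ρ := by
    refine ⟨by fun_prop, ?_⟩
    rw [hasFiniteIntegral_iff_ofReal (.of_forall fun a => normSq_nonneg _)]
    exact lt_top_iff_ne_top.2 htop
  have hlaw : ν.map (fun ω => (A ω, m (A ω) + N ω)) = (ρ.prod (complexGaussianVec r)).map
      (fun p => (p.1, m p.1 + p.2)) := by
    rw [← hind, Measure.map_map (by fun_prop) (by fun_prop)]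
    rfl
  rw [condRelEntropy, hlaw]
  set R := ρ.prod (complexGaussianVec r) with hR
  set T : α × (Fin r → ℂ) → α × (Fin r → ℂ) := fun p => (p.1, m p.1 + p.2) with hT
  have hTm : Measurable T := by fun_prop
  have : IsProbabilityMeasure (R.map T) := Measure.isProbabilityMeasure_map hTm.aemeasurable
  set L : α × (Fin r → ℂ) → ℝ := fun p => 2 * reInner (m p.1) p.2 - normSq (m p.1) with hL
  have hLm : Measurable L := by fun_prop
  have hdens : R.map T = R.withDensity fun p => ENNReal.ofReal (Real.exp (L p)) :=
    map_add_prod_complexGaussianVec ρ hm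
  have hac : R.map T ≪ R := hdens ▸ withDensity_absolutelyContinuous _ _
  have hllr : llr (R.map T) R =ᵐ[R.map T] L := by
    refine hac.ae_le ?_
    have h := Measure.rnDeriv_withDensity R (f := fun p => ENNReal.ofReal (Real.exp (L p)))
      (by fun_prop)
    rw [← hdens] at h
    filter_upwards [h] with p hp
    rw [llr, hp, ENNReal.toReal_ofReal (Real.exp_pos _).le, Real.log_exp]
  -- Evaluated at the channel output, the log-likelihood ratio is the power plus a cross term with
  -- the noise, which is independent and centred, so only the power survives integration.
  have hLT (p : α × (Fin r → ℂ)) : L (T p) = normSq (m p.1) + 2 * reInner (m p.1) p.2 := by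
    simp only [hL, hT, reInner_add_right, reInner_self]
    ring
  have hi1 : Integrable (fun p : α × (Fin r → ℂ) => normSq (m p.1)) R := hsq.comp_fst _
  have hi2 : Integrable (fun p : α × (Fin r → ℂ) => reInner (m p.1) p.2) R :=
    integrable_reInner_complexGaussianVec (integrable_apply_of_integrable_normSq hm hsq)
  have hint : Integrable L (R.map T) := by
    rw [integrable_map_measure hLm.aestronglyMeasurable hTm.aemeasurable]
    exact (hi1.add (hi2.const_mul 2)).congr (.of_forall fun p => (hLT p).symm)
  rw [klDiv_of_ac_of_integrable hac ((integrable_congr hllr).2 hint), integral_congr_ae hllr,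
    integral_map hTm.aemeasurable hLm.aestronglyMeasurable]
  simp only [hLT, probReal_univ]
  rw [integral_add hi1 (hi2.const_mul 2), integral_const_mul,
    integral_reInner_complexGaussianVec (integrable_apply_of_integrable_normSq hm hsq), hR,
    integral_fun_fst (fun a => normSq (m a)), ← ofReal_integral_eq_lintegral_ofReal hsq
      (.of_forall fun a => normSq_nonneg _)]
  simp

lemma normSq_conjTranspose_mulVec_le {V : Matrix (Fin r) (Fin k) ℂ} (hV : Vᴴ * V = 1)
    (y : Fin r → ℂ) : normSq (Vᴴ *ᵥ y) ≤ normSq y := by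
  have h := normSq_sub y (V *ᵥ (Vᴴ *ᵥ y))
  rw [← reInner_conjTranspose_mulVec, reInner_self, normSq_mulVec V hV] at h
  linarith [normSq_nonneg (y - V *ᵥ (Vᴴ *ᵥ y))]

/-- The density, relative to `CN(0, I)`, of the Gaussian law of mean `V Vᴴ u` and of covariance
`I + V Vᴴ` is a probability density. -/
lemma lintegral_exp_normSq_sub {V : Matrix (Fin r) (Fin k) ℂ} (hV : Vᴴ * V = 1)
    (u : Fin r → ℂ) :
    ∫⁻ y, ENNReal.ofReal (Real.exp (normSq (Vᴴ *ᵥ y) - normSq (Vᴴ *ᵥ y - Vᴴ *ᵥ u) / 2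
      - k * Real.log 2)) ∂(complexGaussianVec r) = 1 := by
  set v := Vᴴ *ᵥ u
  have hs2 : ((√2)⁻¹ : ℝ) ^ 2 = 1 / 2 := by
    rw [inv_pow, Real.sq_sqrt (by norm_num)]
    norm_num
  -- The density is linearized: `exp (‖w‖² / 2)` is a moment generating function over an auxiliary
  -- `s ∼ CN(0, I_k)`, so the density becomes an average over `s` of `exp (2 Re⟨y, b s⟩)`. After
  -- Tonelli the integral over `y` is again a moment generating function.
  set b : (Fin k → ℂ) → Fin r → ℂ := fun s =>
    V *ᵥ (((1 / 2 : ℝ) : ℂ) • v + (((√2)⁻¹ : ℝ) : ℂ) • s) with hb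
  have hbm : Measurable b := by fun_prop
  set C : ℝ≥0∞ := ENNReal.ofReal (Real.exp (- normSq v / 2 - k * Real.log 2)) with hC
  have h1 (y : Fin r → ℂ) : ENNReal.ofReal (Real.exp (normSq (Vᴴ *ᵥ y)
      - normSq (Vᴴ *ᵥ y - v) / 2 - k * Real.log 2))
      = C * ∫⁻ s, ENNReal.ofReal (Real.exp (2 * reInner y (b s))) ∂(complexGaussianVec k) := by
    set w := Vᴴ *ᵥ y with hw
    have h2 (s : Fin k → ℂ) : ENNReal.ofReal (Real.exp (2 * reInner y (b s)))
        = ENNReal.ofReal (Real.exp (reInner w v))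
          * ENNReal.ofReal (Real.exp (2 * reInner s ((((√2)⁻¹ : ℝ) : ℂ) • w))) := by
      rw [← ENNReal.ofReal_mul (by positivity), ← Real.exp_add, hb,
        ← reInner_conjTranspose_mulVec, reInner_add_right, reInner_smul_right, reInner_smul_right,
        reInner_smul_right, reInner_comm s w]
      congr 2
      ring
    simp only [h2]
    rw [lintegral_const_mul _ (by fun_prop), lintegral_exp_reInner, normSq_smul, hs2, hC,
      ← ENNReal.ofReal_mul (by positivity), ← ENNReal.ofReal_mul (by positivity), ← Real.exp_add,
      ← Real.exp_add, normSq_sub]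
    congr 2
    ring
  simp only [h1]
  rw [lintegral_const_mul _ (Measurable.lintegral_prod_right'
    (f := fun p : (Fin r → ℂ) × (Fin k → ℂ) => ENNReal.ofReal (Real.exp (2 * reInner p.1 (b p.2))))
    (by fun_prop)), lintegral_lintegral_swap (by fun_prop)]
  simp only [lintegral_exp_reInner]
  have h3 (s : Fin k → ℂ) : ENNReal.ofReal (Real.exp (normSq (b s)))
      = ENNReal.ofReal (Real.exp (normSq v / 4))
        * ENNReal.ofReal (Real.exp (normSq s / 2 + reInner s v / √2)) := by
    rw [← ENNReal.ofReal_mul (by positivity), ← Real.exp_add, hb, normSq_mulVec V hV, normSq_add,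
      normSq_smul, normSq_smul, reInner_smul_left, reInner_smul_right, hs2, reInner_comm v s]
    congr 2
    ring
  simp only [h3]
  rw [lintegral_const_mul _ (by fun_prop), lintegral_exp_normSq_div_two, hC,
    ← ENNReal.ofReal_mul (by positivity), ← ENNReal.ofReal_mul (by positivity),
    ← ENNReal.ofReal_one]
  congr 1
  have h4 : (2 : ℝ) ^ k = Real.exp (k * Real.log 2) := by
    rw [Real.exp_nat_mul, Real.exp_log two_pos]
  rw [h4, ← Real.exp_add, ← Real.exp_add, ← Real.exp_add, Real.exp_eq_one_iff]
  ring

/-- The integral which computes the entropy gap of an independent copy of the noise. -/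
lemma integrable_integral_gap (ρ : Measure α) [IsProbabilityMeasure ρ] {x : α → Fin r → ℂ}
    (hx : Measurable x) (hsq : Integrable (fun a => normSq (x a)) ρ)
    {V : Matrix (Fin r) (Fin k) ℂ} (hV : Vᴴ * V = 1) (K : ℝ)
    (f : (α × (Fin r → ℂ)) × (Fin r → ℂ) → ℝ)
    (hf : ∀ ω, f ω = normSq (x ω.1.1) - K + 2 * reInner (x ω.1.1) ω.2
        + reInner (V *ᵥ (Vᴴ *ᵥ ω.1.2)) ω.2
        + (normSq (Vᴴ *ᵥ ω.2) / 2 - normSq (Vᴴ *ᵥ ω.1.2) / 2)) :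
    Integrable f ((ρ.prod (complexGaussianVec r)).prod (complexGaussianVec r)) ∧
    ∫ ω, f ω ∂((ρ.prod (complexGaussianVec r)).prod (complexGaussianVec r))
      = ∫ a, normSq (x a) ∂ρ - K := by
  obtain rfl := funext hf
  have hw : Integrable (fun z : Fin r → ℂ => normSq (Vᴴ *ᵥ z) / 2) (complexGaussianVec r) := by
    refine Integrable.div_const ?_ 2
    refine integrable_normSq_complexGaussianVec.mono' (by fun_prop) (.of_forall fun z => ?_)
    rw [Real.norm_of_nonneg (normSq_nonneg _)]
    exact normSq_conjTranspose_mulVec_le hV z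
  have hw1 (i : Fin r) : Integrable (fun z : Fin r → ℂ => (V *ᵥ (Vᴴ *ᵥ z)) i)
      (complexGaussianVec r) := by
    refine integrable_apply_of_integrable_normSq (by fun_prop) ?_ i
    simp only [normSq_mulVec V hV]
    simpa using hw.mul_const 2
  -- Both cross terms pair a function of the first two coordinates with the last noise, hence have
  -- mean zero.
  have hc1 (i : Fin r) : Integrable (fun a : α × (Fin r → ℂ) => x a.1 i)
      (ρ.prod (complexGaussianVec r)) :=
    (integrable_apply_of_integrable_normSq hx hsq i).comp_fst _
  have hc2 (i : Fin r) : Integrable (fun a : α × (Fin r → ℂ) => (V *ᵥ (Vᴴ *ᵥ a.2)) i)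
      (ρ.prod (complexGaussianVec r)) :=
    (hw1 i).comp_snd _
  have hi2 := integrable_reInner_complexGaussianVec hc1
  have hi3 := integrable_reInner_complexGaussianVec hc2
  have he2 := integral_reInner_complexGaussianVec hc1
  have he3 := integral_reInner_complexGaussianVec hc2
  have hq := hsq.comp_fst (complexGaussianVec r)
  have hq' : ∫ a, normSq (x a.1) ∂(ρ.prod (complexGaussianVec r)) = ∫ a, normSq (x a) ∂ρ :=
    (integral_fun_fst (fun a => normSq (x a))).trans (by simp)
  have hv := hw.comp_snd ρ
  have hv' : ∫ a, normSq (Vᴴ *ᵥ a.2) / 2 ∂(ρ.prod (complexGaussianVec r))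
      = ∫ z, normSq (Vᴴ *ᵥ z) / 2 ∂(complexGaussianVec r) :=
    (integral_fun_snd (fun z => normSq (Vᴴ *ᵥ z) / 2)).trans (by simp)
  have hρ : IsProbabilityMeasure (ρ.prod (complexGaussianVec r)) := inferInstance
  generalize ρ.prod (complexGaussianVec r) = ρ' at *
  have hi1 := (hq.comp_fst (complexGaussianVec r)).sub (integrable_const K)
  have hi4 := (hw.comp_snd ρ').sub (hv.comp_fst (complexGaussianVec r))
  have hi12 := hi1.add (hi2.const_mul 2)
  have hi123 := hi12.add hi3
  have he1 : ∫ ω : (α × (Fin r → ℂ)) × (Fin r → ℂ), (normSq (x ω.1.1) - K)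
      ∂(ρ'.prod (complexGaussianVec r)) = ∫ a, normSq (x a) ∂ρ - K := by
    rw [integral_fun_fst (fun a : α × (Fin r → ℂ) => normSq (x a.1) - K),
      integral_sub hq (integrable_const _), hq']
    simp
  -- The two projected noises have the same law, so their energies cancel.
  have he4 : ∫ ω : (α × (Fin r → ℂ)) × (Fin r → ℂ),
      (normSq (Vᴴ *ᵥ ω.2) / 2 - normSq (Vᴴ *ᵥ ω.1.2) / 2)
      ∂(ρ'.prod (complexGaussianVec r)) = 0 := by
    rw [integral_sub (hw.comp_snd ρ') (hv.comp_fst (complexGaussianVec r)),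
      integral_fun_snd (fun z => normSq (Vᴴ *ᵥ z) / 2),
      integral_fun_fst (fun a : α × (Fin r → ℂ) => normSq (Vᴴ *ᵥ a.2) / 2), hv']
    simp
  refine ⟨hi123.add hi4, ?_⟩
  refine (integral_add hi123 hi4).trans ?_
  rw [integral_add' hi12 hi3, integral_add' hi1 (hi2.const_mul 2), integral_const_mul, he2, he3]
  simp only [Pi.sub_apply]
  rw [he1, he4]
  ring

/-- Observing the input of a Gaussian channel through an independent copy of the noise loses at
most one bit per dimension of the signal space. -/
lemma ofReal_sub_le_condRelEntropy (ρ : Measure α) [IsProbabilityMeasure ρ] {x : α → Fin r → ℂ}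
    (hx : Measurable x) (hsq : Integrable (fun a => normSq (x a)) ρ) {S : α → γ}
    (hS : Measurable S) {V : Matrix (Fin r) (Fin k) ℂ} (hV : Vᴴ * V = 1)
    (hVx : ∀ a, V *ᵥ (Vᴴ *ᵥ x a) = x a) :
    ENNReal.ofReal (∫ a, normSq (x a) ∂ρ - k * Real.log 2)
      ≤ condRelEntropy ((ρ.prod (complexGaussianVec r)).prod (complexGaussianVec r))
        (fun ω => (S ω.1.1, x ω.1.1 + ω.1.2)) (fun ω => x ω.1.1 + ω.2)
        (complexGaussianVec r) := by
  set ρ' := ρ.prod (complexGaussianVec r) with hρ'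
  set ν := ρ'.prod (complexGaussianVec r) with hν
  set Z : (α × (Fin r → ℂ)) × (Fin r → ℂ) → γ × (Fin r → ℂ) :=
    fun ω => (S ω.1.1, x ω.1.1 + ω.1.2)
  set Y : (α × (Fin r → ℂ)) × (Fin r → ℂ) → Fin r → ℂ := fun ω => x ω.1.1 + ω.2
  have hZ : Measurable Z := by fun_prop
  have hY : Measurable Y := by fun_prop
  have : IsProbabilityMeasure (ν.map fun ω => (Z ω, Y ω)) :=
    Measure.isProbabilityMeasure_map (by fun_prop)
  have : IsProbabilityMeasure (ν.map Z) := Measure.isProbabilityMeasure_map (by fun_prop)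
  -- The test function is the log-density, relative to the noise, of the Gaussian law of mean `V Vᴴ
  -- u` and covariance `I + V Vᴴ`, with `u` the noisy copy. The side information `S` does not enter
  -- it.
  set f : (γ × (Fin r → ℂ)) × (Fin r → ℂ) → ℝ := fun p =>
    normSq (Vᴴ *ᵥ p.2) - normSq (Vᴴ *ᵥ p.2 - Vᴴ *ᵥ p.1.2) / 2 - k * Real.log 2 with hf
  have hfm : Measurable f := by fun_prop
  have hexp : ∫⁻ p, ENNReal.ofReal (Real.exp (f p)) ∂((ν.map Z).prod (complexGaussianVec r))
      ≤ 1 := by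
    rw [lintegral_prod _ (by fun_prop)]
    simp only [hf, lintegral_exp_normSq_sub hV]
    simp
  have hnx (a : α) : normSq (Vᴴ *ᵥ x a) = normSq (x a) := by
    rw [← normSq_mulVec V hV, hVx]
  have hfZY (ω : (α × (Fin r → ℂ)) × (Fin r → ℂ)) : f (Z ω, Y ω)
      = normSq (x ω.1.1) - k * Real.log 2 + 2 * reInner (x ω.1.1) ω.2
        + reInner (V *ᵥ (Vᴴ *ᵥ ω.1.2)) ω.2
        + (normSq (Vᴴ *ᵥ ω.2) / 2 - normSq (Vᴴ *ᵥ ω.1.2) / 2) := by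
    have h1 : reInner (x ω.1.1) ω.2 = reInner (Vᴴ *ᵥ x ω.1.1) (Vᴴ *ᵥ ω.2) := by
      nth_rw 1 [← hVx]
      rw [reInner_comm, ← reInner_conjTranspose_mulVec, reInner_comm]
    have h2 : reInner (V *ᵥ (Vᴴ *ᵥ ω.1.2)) ω.2 = reInner (Vᴴ *ᵥ ω.2) (Vᴴ *ᵥ ω.1.2) := by
      rw [reInner_comm, ← reInner_conjTranspose_mulVec]
    simp only [hf, Z, Y, Matrix.mulVec_add, add_sub_add_left_eq_sub]
    rw [normSq_add, normSq_sub, h1, h2, hnx]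
    ring
  obtain ⟨hint, heq⟩ := integrable_integral_gap ρ hx hsq hV (k * Real.log 2)
    (fun ω => f (Z ω, Y ω)) hfZY
  have hint' : Integrable f (ν.map fun ω => (Z ω, Y ω)) := by
    rw [integrable_map_measure hfm.aestronglyMeasurable (by fun_prop)]
    exact hint
  refine le_trans (le_of_eq ?_) (ofReal_integral_le_klDiv _ _ hfm hint' hexp)
  rw [integral_map (by fun_prop) hfm.aestronglyMeasurable, heq]

/-- An orthonormal basis of the column space of a matrix. -/
lemma exists_isometry_mul_conjTranspose_mul (G : Matrix (Fin r) (Fin t) ℂ) :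
    ∃ k ≤ min t r, ∃ V : Matrix (Fin r) (Fin k) ℂ, Vᴴ * V = 1 ∧ V * Vᴴ * G = G := by
  let f := Matrix.toEuclideanLin G
  let S := LinearMap.range f
  let b := stdOrthonormalBasis ℂ S
  refine ⟨Module.finrank ℂ S, le_min ?_ ?_, Matrix.of fun i j => (b j : EuclideanSpace ℂ (Fin r)) i,
    ?_, ?_⟩
  · simpa using LinearMap.finrank_range_le f
  · simpa using Submodule.finrank_le S
  · ext i j
    have h := orthonormal_iff_ite.1 b.orthonormal i j
    rw [Submodule.coe_inner, PiLp.inner_apply] at h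
    simp only [Matrix.mul_apply, Matrix.conjTranspose_apply, Matrix.of_apply, Matrix.one_apply]
    rw [← h]
    simp [mul_comm]
  · ext i j
    have hmem : f (EuclideanSpace.single j 1) ∈ S := LinearMap.mem_range_self _ _
    -- Expand the `j`-th column of `G` in the orthonormal basis and read off coordinate `i`.
    have h := congrArg (fun s : S => (s : EuclideanSpace ℂ (Fin r)) i) (b.sum_repr' ⟨_, hmem⟩)
    simp [f, Matrix.toLpLin_apply, PiLp.inner_apply] at h
    rw [Matrix.mul_assoc]
    simp only [Matrix.mul_apply, Matrix.conjTranspose_apply, Matrix.of_apply]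
    conv_rhs => rw [← h]
    refine Finset.sum_congr rfl fun x _ => ?_
    rw [mul_comm]
    congr 1
    exact Finset.sum_congr rfl fun _ _ => mul_comm _ _

end GaussianBounds

/-! ### Second-moment bounds, uniform over the laws satisfying the power constraints. -/

section PowerBounds

variable {r t t₁ t₂ : ℕ}

/-- Cauchy–Schwarz in each row; the constant is the squared Frobenius norm. -/
lemma exists_normSq_mulVec_le (M : Matrix (Fin r) (Fin t) ℂ) :
    ∃ C : ℝ, 0 ≤ C ∧ ∀ x, normSq (M *ᵥ x) ≤ C * normSq x := by
  refine ⟨∑ i, ∑ j, ‖M i j‖ ^ 2, by positivity, fun x => ?_⟩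
  rw [normSq, Finset.sum_mul]
  refine Finset.sum_le_sum fun i _ => ?_
  have h : ‖(M *ᵥ x) i‖ ≤ ∑ j, ‖M i j‖ * ‖x j‖ := by
    simp only [Matrix.mulVec, dotProduct, ← norm_mul]
    exact norm_sum_le _ _
  exact (pow_le_pow_left₀ (norm_nonneg _) h 2).trans (Finset.sum_mul_sq_le_sq_mul_sq _ _ _)

lemma ofReal_normSq (x : Fin t → ℂ) : ENNReal.ofReal (normSq x) = ∑ i, ‖x i‖ₑ ^ 2 := by
  rw [normSq, ENNReal.ofReal_sum_of_nonneg fun _ _ => by positivity]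
  refine Finset.sum_congr rfl fun i _ => ?_
  rw [ENNReal.ofReal_pow (norm_nonneg _), ofReal_norm]

lemma normSq_add_le (x y : Fin t → ℂ) : normSq (x + y) ≤ 2 * normSq x + 2 * normSq y := by
  have h := normSq_nonneg (x - y)
  rw [normSq_sub] at h
  rw [normSq_add]
  linarith

lemma exists_lintegral_normSq_mulVec_le (M : Matrix (Fin r) (Fin t) ℂ) (P : ℝ) :
    ∃ B : ℝ≥0∞, B ≠ ∞ ∧ ∀ {E : Type} [MeasurableSpace E] (μ : ProbabilityMeasure E)
      (X : E → Fin t → ℂ), Measurable X → PowerConstraint P μ X →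
      ∫⁻ e, ENNReal.ofReal (normSq (M *ᵥ X e)) ∂μ.toMeasure ≤ B := by
  obtain ⟨C, hC, hM⟩ := exists_normSq_mulVec_le M
  refine ⟨ENNReal.ofReal C * ENNReal.ofReal P, by finiteness, fun μ X hX hμ => ?_⟩
  calc _ ≤ ∫⁻ e, ENNReal.ofReal C * ENNReal.ofReal (normSq (X e)) ∂μ.toMeasure := by
        refine lintegral_mono fun e => ?_
        rw [← ENNReal.ofReal_mul hC]
        exact ENNReal.ofReal_le_ofReal (hM _)
    _ ≤ _ := by
        rw [lintegral_const_mul _ (by fun_prop)]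
        simp only [ofReal_normSq]
        exact mul_le_mul_right hμ _

lemma exists_lintegral_normSq_mulVec_add_le (M₁ : Matrix (Fin r) (Fin t₁) ℂ)
    (M₂ : Matrix (Fin r) (Fin t₂) ℂ) (P : ℝ) :
    ∃ B : ℝ≥0∞, B ≠ ∞ ∧ ∀ {E : Type} [MeasurableSpace E] (μ : ProbabilityMeasure E)
      (X₁ : E → Fin t₁ → ℂ) (X₂ : E → Fin t₂ → ℂ), Measurable X₁ → Measurable X₂ →
      PowerConstraint P μ X₁ → PowerConstraint P μ X₂ →
      ∫⁻ e, ENNReal.ofReal (normSq (M₁ *ᵥ X₁ e + M₂ *ᵥ X₂ e)) ∂μ.toMeasure ≤ B := by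
  obtain ⟨B₁, hB₁, h₁⟩ := exists_lintegral_normSq_mulVec_le M₁ P
  obtain ⟨B₂, hB₂, h₂⟩ := exists_lintegral_normSq_mulVec_le M₂ P
  refine ⟨2 * B₁ + 2 * B₂, by finiteness, fun μ X₁ X₂ hX₁ hX₂ hμ₁ hμ₂ => ?_⟩
  calc _ ≤ ∫⁻ e, (2 * ENNReal.ofReal (normSq (M₁ *ᵥ X₁ e))
        + 2 * ENNReal.ofReal (normSq (M₂ *ᵥ X₂ e))) ∂μ.toMeasure := by
        refine lintegral_mono fun e => ?_
        rw [← ENNReal.ofReal_ofNat 2, ← ENNReal.ofReal_mul zero_le_two,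
          ← ENNReal.ofReal_mul zero_le_two, ← ENNReal.ofReal_add
          (mul_nonneg zero_le_two (normSq_nonneg _)) (mul_nonneg zero_le_two (normSq_nonneg _))]
        exact ENNReal.ofReal_le_ofReal (normSq_add_le _ _)
    _ ≤ _ := by
        rw [lintegral_add_left (by fun_prop), lintegral_const_mul _ (by fun_prop),
          lintegral_const_mul _ (by fun_prop)]
        exact add_le_add (mul_le_mul_right (h₁ μ X₁ hX₁ hμ₁) _)
          (mul_le_mul_right (h₂ μ X₂ hX₂ hμ₂) _)

end PowerBounds

/-! ### Independence of the noises and power bounds for the two outputs. -/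

section JointLaw

variable {E α : Type*} [MeasurableSpace E] [MeasurableSpace α] {r₂ r₃ t₁ t₂ : ℕ}

lemma measurePreserving_jointLaw_fst (μ : ProbabilityMeasure E) :
    MeasurePreserving (fun ω : E × (Fin r₂ → ℂ) × (Fin r₃ → ℂ) => ω.1) (jointLaw r₂ r₃ μ) μ :=
  measurePreserving_fst

lemma measurePreserving_jointLaw_relay (μ : ProbabilityMeasure E) :
    MeasurePreserving (fun ω : E × (Fin r₂ → ℂ) × (Fin r₃ → ℂ) => (ω.1, ω.2.1))
      (jointLaw r₂ r₃ μ) (μ.toMeasure.prod (complexGaussianVec r₂)) :=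
  (MeasurePreserving.id μ.toMeasure).prod measurePreserving_fst

lemma map_jointLaw_relay (μ : ProbabilityMeasure E) {g : E → α} (hg : Measurable g) :
    (jointLaw r₂ r₃ μ).map (fun ω => (g ω.1, ω.2.1))
      = ((jointLaw r₂ r₃ μ).map fun ω => g ω.1).prod (complexGaussianVec r₂) := by
  have h1 : (jointLaw r₂ r₃ μ).map (fun ω => g ω.1) = μ.toMeasure.map g := by
    rw [← (measurePreserving_jointLaw_fst (r₂ := r₂) (r₃ := r₃) μ).map_eq,
      Measure.map_map hg (by fun_prop)]
    rfl
  have h2 := (measurePreserving_jointLaw_relay (r₂ := r₂) (r₃ := r₃) μ).map_eq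
  calc _ = ((jointLaw r₂ r₃ μ).map fun ω => (ω.1, ω.2.1)).map (Prod.map g id) := by
        rw [Measure.map_map (by fun_prop) (by fun_prop)]
        rfl
    _ = _ := by rw [h1, h2, ← Measure.map_prod_map _ _ hg measurable_id, Measure.map_id]

/-- The receiver noise is independent of the input and the relay noise jointly, so the conditioning
variable may include the relay output. -/
lemma map_jointLaw_receiver (μ : ProbabilityMeasure E) {g : E × (Fin r₂ → ℂ) → α}
    (hg : Measurable g) :
    (jointLaw r₂ r₃ μ).map (fun ω => (g (ω.1, ω.2.1), ω.2.2))
      = ((jointLaw r₂ r₃ μ).map fun ω => g (ω.1, ω.2.1)).prod (complexGaussianVec r₃) := by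
  have h1 : (jointLaw r₂ r₃ μ).map (fun ω => g (ω.1, ω.2.1))
      = (μ.toMeasure.prod (complexGaussianVec r₂)).map g := by
    rw [← (measurePreserving_jointLaw_relay (r₂ := r₂) (r₃ := r₃) μ).map_eq,
      Measure.map_map hg (by fun_prop)]
    rfl
  have h2 := ((measurePreserving_prodAssoc μ.toMeasure (complexGaussianVec r₂)
    (complexGaussianVec r₃)).symm MeasurableEquiv.prodAssoc).map_eq
  calc _ = ((jointLaw r₂ r₃ μ).map MeasurableEquiv.prodAssoc.symm).map (Prod.map g id) := by
        rw [Measure.map_map (by fun_prop) (by fun_prop)]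
        rfl
    _ = _ := by
        rw [h1, jointLaw, h2, ← Measure.map_prod_map _ _ hg measurable_id, Measure.map_id]

lemma condRelEntropy_outputY₂_le (G₂₁ : Matrix (Fin r₂) (Fin t₁) ℂ) (μ : ProbabilityMeasure E)
    {g : E → α} (hg : Measurable g) {x₁ : α → Fin t₁ → ℂ} (hx₁ : Measurable x₁) :
    condRelEntropy (jointLaw r₂ r₃ μ) (fun ω => g ω.1)
      (fun ω => outputY₂ G₂₁ (x₁ (g ω.1)) ω.2.1) (complexGaussianVec r₂)
      ≤ ∫⁻ e, ENNReal.ofReal (normSq (G₂₁ *ᵥ x₁ (g e))) ∂μ.toMeasure := by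
  refine (condRelEntropy_add_le (jointLaw r₂ r₃ μ) (A := fun ω => g ω.1) (N := fun ω => ω.2.1)
    (m := fun a => G₂₁ *ᵥ x₁ a) (by fun_prop) (by fun_prop) (by fun_prop)
    (map_jointLaw_relay μ hg)).trans (le_of_eq ?_)
  exact (measurePreserving_jointLaw_fst μ).lintegral_comp
    (f := fun e => ENNReal.ofReal (normSq (G₂₁ *ᵥ x₁ (g e)))) (by fun_prop)

/-- The maps `x₁` and `x₂` recover the inputs from the conditioning variable, which makes the
noiseless output a function of it, as `condRelEntropy_add_le` requires. -/
lemma condRelEntropy_outputY₃_le (G₃₁ : Matrix (Fin r₃) (Fin t₁) ℂ)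
    (G₃₂ : Matrix (Fin r₃) (Fin t₂) ℂ) (μ : ProbabilityMeasure E) {g : E × (Fin r₂ → ℂ) → α}
    (hg : Measurable g) {x₁ : α → Fin t₁ → ℂ} (hx₁ : Measurable x₁) {x₂ : α → Fin t₂ → ℂ}
    (hx₂ : Measurable x₂) {X₁ : E → Fin t₁ → ℂ} (hX₁ : Measurable X₁) {X₂ : E → Fin t₂ → ℂ}
    (hX₂ : Measurable X₂) (h₁ : ∀ p, x₁ (g p) = X₁ p.1) (h₂ : ∀ p, x₂ (g p) = X₂ p.1) :
    condRelEntropy (jointLaw r₂ r₃ μ) (fun ω => g (ω.1, ω.2.1))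
      (fun ω => outputY₃ G₃₁ G₃₂ (X₁ ω.1) (X₂ ω.1) ω.2.2) (complexGaussianVec r₃)
      ≤ ∫⁻ e, ENNReal.ofReal (normSq (G₃₁ *ᵥ X₁ e + G₃₂ *ᵥ X₂ e)) ∂μ.toMeasure := by
  have h := condRelEntropy_add_le (jointLaw r₂ r₃ μ) (A := fun ω => g (ω.1, ω.2.1))
    (N := fun ω => ω.2.2) (m := fun a => G₃₁ *ᵥ x₁ a + G₃₂ *ᵥ x₂ a) (by fun_prop) (by fun_prop)
    (by fun_prop) (map_jointLaw_receiver μ hg)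
  simp only [h₁, h₂] at h
  refine h.trans (le_of_eq ?_)
  exact (measurePreserving_jointLaw_fst μ).lintegral_comp
    (f := fun e => ENNReal.ofReal (normSq (G₃₁ *ᵥ X₁ e + G₃₂ *ᵥ X₂ e))) (by fun_prop)

@[fun_prop]
lemma _root_.Measurable.outputY₂ {G₂₁ : Matrix (Fin r₂) (Fin t₁) ℂ} {x : α → Fin t₁ → ℂ}
    {z : α → Fin r₂ → ℂ} (hx : Measurable x) (hz : Measurable z) :
    Measurable fun a => MIMORelay.outputY₂ G₂₁ (x a) (z a) := by
  unfold MIMORelay.outputY₂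
  fun_prop

@[fun_prop]
lemma _root_.Measurable.outputY₃ {G₃₁ : Matrix (Fin r₃) (Fin t₁) ℂ}
    {G₃₂ : Matrix (Fin r₃) (Fin t₂) ℂ} {x : α → Fin t₁ → ℂ} {y : α → Fin t₂ → ℂ}
    {z : α → Fin r₃ → ℂ} (hx : Measurable x) (hy : Measurable y) (hz : Measurable z) :
    Measurable fun a => MIMORelay.outputY₃ G₃₁ G₃₂ (x a) (y a) (z a) := by
  unfold MIMORelay.outputY₃
  fun_prop

end JointLaw

/-! ### The auxiliary variable as a noisy copy of the relay output. -/

section Comparison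

variable {t₁ t₂ r₂ r₃ : ℕ}

/-- The law of `(U, X₁, X₂)` in which `U` is a copy of the relay output with a fresh noise. -/
def relayCopyLaw (G₂₁ : Matrix (Fin r₂) (Fin t₁) ℂ)
    (μ : ProbabilityMeasure ((Fin t₁ → ℂ) × (Fin t₂ → ℂ))) :
    ProbabilityMeasure ((Fin r₂ → ℂ) × (Fin t₁ → ℂ) × (Fin t₂ → ℂ)) :=
  ⟨(μ.toMeasure.prod (complexGaussianVec r₂)).map fun p => (outputY₂ G₂₁ p.1.1 p.2, p.1),
    Measure.isProbabilityMeasure_map (by fun_prop)⟩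

lemma measurePreserving_relayCopyLaw (G₂₁ : Matrix (Fin r₂) (Fin t₁) ℂ)
    (μ : ProbabilityMeasure ((Fin t₁ → ℂ) × (Fin t₂ → ℂ))) :
    MeasurePreserving (fun p => (outputY₂ G₂₁ p.1.1 p.2, p.1))
      (μ.toMeasure.prod (complexGaussianVec r₂)) (relayCopyLaw G₂₁ μ) :=
  ⟨by fun_prop, rfl⟩

lemma measurePreserving_snd_relayCopyLaw (G₂₁ : Matrix (Fin r₂) (Fin t₁) ℂ)
    (μ : ProbabilityMeasure ((Fin t₁ → ℂ) × (Fin t₂ → ℂ))) :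
    MeasurePreserving Prod.snd (relayCopyLaw G₂₁ μ).toMeasure μ.toMeasure := by
  refine ⟨measurable_snd, ?_⟩
  rw [← (measurePreserving_relayCopyLaw G₂₁ μ).map_eq,
    Measure.map_map measurable_snd (by fun_prop)]
  exact measurePreserving_fst.map_eq

lemma powerConstraint_relayCopyLaw {G₂₁ : Matrix (Fin r₂) (Fin t₁) ℂ}
    {μ : ProbabilityMeasure ((Fin t₁ → ℂ) × (Fin t₂ → ℂ))} {P : ℝ} {t : ℕ}
    {X : (Fin t₁ → ℂ) × (Fin t₂ → ℂ) → Fin t → ℂ} (hX : Measurable X)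
    (h : PowerConstraint P μ X) : PowerConstraint P (relayCopyLaw G₂₁ μ) fun e => X e.2 :=
  ((measurePreserving_snd_relayCopyLaw G₂₁ μ).lintegral_comp
    (f := fun e => ∑ i, ‖X e i‖ₑ ^ 2) (by fun_prop)).trans_le h

lemma measurePreserving_jointLaw_relayCopyLaw (G₂₁ : Matrix (Fin r₂) (Fin t₁) ℂ)
    (μ : ProbabilityMeasure ((Fin t₁ → ℂ) × (Fin t₂ → ℂ))) :
    MeasurePreserving (fun p : (((Fin t₁ → ℂ) × (Fin t₂ → ℂ)) × (Fin r₂ → ℂ)) ×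
        (Fin r₂ → ℂ) × (Fin r₃ → ℂ) => ((outputY₂ G₂₁ p.1.1.1 p.1.2, p.1.1), p.2))
      ((μ.toMeasure.prod (complexGaussianVec r₂)).prod
        ((complexGaussianVec r₂).prod (complexGaussianVec r₃)))
      (jointLaw r₂ r₃ (relayCopyLaw G₂₁ μ)) :=
  (measurePreserving_relayCopyLaw G₂₁ μ).prod (MeasurePreserving.id _)

/-- Forgetting the auxiliary variable. -/
lemma measurePreserving_jointLaw_forget (G₂₁ : Matrix (Fin r₂) (Fin t₁) ℂ)
    (μ : ProbabilityMeasure ((Fin t₁ → ℂ) × (Fin t₂ → ℂ))) :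
    MeasurePreserving (fun ω : ((Fin r₂ → ℂ) × (Fin t₁ → ℂ) × (Fin t₂ → ℂ)) ×
        (Fin r₂ → ℂ) × (Fin r₃ → ℂ) => (ω.1.2, ω.2))
      (jointLaw r₂ r₃ (relayCopyLaw G₂₁ μ)) (jointLaw r₂ r₃ μ) :=
  (measurePreserving_snd_relayCopyLaw G₂₁ μ).prod (MeasurePreserving.id _)

/-- Exchanging the relay output with the auxiliary variable. -/
lemma measurePreserving_jointLaw_exchange (G₂₁ : Matrix (Fin r₂) (Fin t₁) ℂ)
    (μ : ProbabilityMeasure ((Fin t₁ → ℂ) × (Fin t₂ → ℂ))) :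
    MeasurePreserving (fun ω : ((Fin r₂ → ℂ) × (Fin t₁ → ℂ) × (Fin t₂ → ℂ)) ×
        (Fin r₂ → ℂ) × (Fin r₃ → ℂ) => (ω.1.2, (ω.1.1 - G₂₁ *ᵥ ω.1.2.1, ω.2.2)))
      (jointLaw r₂ r₃ (relayCopyLaw G₂₁ μ)) (jointLaw r₂ r₃ μ) := by
  refine ⟨by fun_prop, ?_⟩
  rw [← (measurePreserving_jointLaw_relayCopyLaw G₂₁ μ).map_eq,
    Measure.map_map (by fun_prop) (by fun_prop)]
  -- In terms of the independent variables the composite map is `((e, z'), (z₂, z₃)) ↦ (e, (z',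
  -- z₃))`: the fresh noise replaces the relay noise.
  have h := (measurePreserving_prodAssoc μ.toMeasure
    (complexGaussianVec r₂) (complexGaussianVec r₃)).comp
    ((MeasurePreserving.id (μ.toMeasure.prod (complexGaussianVec r₂))).prod
      (measurePreserving_snd (μ := complexGaussianVec r₂) (ν := complexGaussianVec r₃)))
  rw [jointLaw, ← h.map_eq]
  congr 1
  ext1 p
  simp [outputY₂, MeasurableEquiv.prodAssoc]

/-- Replacing the input by a copy of the relay output loses at most one bit per dimension. -/
lemma exists_condRelEntropy_outputY₂_le (G₂₁ : Matrix (Fin r₂) (Fin t₁) ℂ) :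
    ∃ k ≤ min t₁ r₂, ∀ (μ : ProbabilityMeasure ((Fin t₁ → ℂ) × (Fin t₂ → ℂ))),
      ∫⁻ e, ENNReal.ofReal (normSq (G₂₁ *ᵥ e.1)) ∂μ.toMeasure ≠ ∞ →
      ∫⁻ e, ENNReal.ofReal (normSq (G₂₁ *ᵥ e.1)) ∂μ.toMeasure
        ≤ condRelEntropy (jointLaw r₂ r₃ (relayCopyLaw G₂₁ μ)) (fun ω => (ω.1.2.2, ω.1.1))
          (fun ω => outputY₂ G₂₁ ω.1.2.1 ω.2.1) (complexGaussianVec r₂)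
          + k * ENNReal.ofReal (Real.log 2) := by
  obtain ⟨k, hk, V, hV, hVG⟩ := exists_isometry_mul_conjTranspose_mul G₂₁
  refine ⟨k, hk, fun μ hμ => ?_⟩
  have hsq : Integrable (fun e : (Fin t₁ → ℂ) × (Fin t₂ → ℂ) => normSq (G₂₁ *ᵥ e.1))
      μ.toMeasure := by
    refine ⟨by fun_prop, ?_⟩
    rw [hasFiniteIntegral_iff_ofReal (.of_forall fun _ => normSq_nonneg _)]
    exact lt_top_iff_ne_top.2 hμ
  have h := ofReal_sub_le_condRelEntropy μ.toMeasure
    (x := fun e => G₂₁ *ᵥ e.1) (by fun_prop) hsq (S := Prod.snd) measurable_snd hV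
    (fun e => by rw [Matrix.mulVec_mulVec, Matrix.mulVec_mulVec, hVG])
  have hπ := (MeasurePreserving.id (μ.toMeasure.prod (complexGaussianVec r₂))).prod
    (measurePreserving_fst (μ := complexGaussianVec r₂) (ν := complexGaussianVec r₃))
  rw [← condRelEntropy_comp_measurePreserving hπ (by fun_prop) (by fun_prop)] at h
  rw [← condRelEntropy_comp_measurePreserving (measurePreserving_jointLaw_relayCopyLaw G₂₁ μ)
    (by fun_prop) (by fun_prop), ← ofReal_integral_eq_lintegral_ofReal hsq
      (.of_forall fun _ => normSq_nonneg _), ← ENNReal.ofReal_natCast,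
    ← ENNReal.ofReal_mul (Nat.cast_nonneg k)]
  refine le_trans ?_ (add_le_add_left h _)
  -- Subadditivity of `ENNReal.ofReal` suffices, whatever the sign of the power minus `k log 2`.
  refine le_trans (le_of_eq ?_) ENNReal.ofReal_add_le
  congr 1
  ring

end Comparison

/-! ### Finiteness and the gap between the two bounds. -/

section Gap

variable {t₁ t₂ r₂ r₃ : ℕ}

/-- The constant is chosen before the space `E`, so it serves every dimension of the auxiliary
variable at once. -/
lemma exists_mutualInfo_outputY₃_le (G₃₁ : Matrix (Fin r₃) (Fin t₁) ℂ)
    (G₃₂ : Matrix (Fin r₃) (Fin t₂) ℂ) (P : ℝ) :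
    ∃ B : ℝ≥0∞, B ≠ ∞ ∧ ∀ {E : Type} [MeasurableSpace E] (μ : ProbabilityMeasure E)
      (X₁ : E → Fin t₁ → ℂ) (X₂ : E → Fin t₂ → ℂ), Measurable X₁ → Measurable X₂ →
      PowerConstraint P μ X₁ → PowerConstraint P μ X₂ →
      mutualInfo (jointLaw r₂ r₃ μ) (fun ω => (X₁ ω.1, X₂ ω.1))
        (fun ω => outputY₃ G₃₁ G₃₂ (X₁ ω.1) (X₂ ω.1) ω.2.2) ≤ B := by
  obtain ⟨B, hB, h⟩ := exists_lintegral_normSq_mulVec_add_le G₃₁ G₃₂ P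
  have h2 : ENNReal.ofReal (Real.log 2) ≠ 0 := by simpa using Real.log_pos one_lt_two
  refine ⟨B / ENNReal.ofReal (Real.log 2), ENNReal.div_ne_top hB h2,
    fun μ X₁ X₂ hX₁ hX₂ hμ₁ hμ₂ => ?_⟩
  rw [ENNReal.le_div_iff_mul_le (.inl h2) (.inl ENNReal.ofReal_ne_top)]
  exact ((mutualInfo_mul_log_two_le _ (complexGaussianVec r₃) (by fun_prop) (by fun_prop)).trans
    (condRelEntropy_outputY₃_le G₃₁ G₃₂ μ (g := fun p => (X₁ p.1, X₂ p.1)) (by fun_prop)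
      (x₁ := Prod.fst) measurable_fst (x₂ := Prod.snd) measurable_snd hX₁ hX₂ (fun _ => rfl)
      (fun _ => rfl))).trans (h μ X₁ X₂ hX₁ hX₂ hμ₁ hμ₂)

lemma exists_cutsetRate_le (G₂₁ : Matrix (Fin r₂) (Fin t₁) ℂ) (G₃₁ : Matrix (Fin r₃) (Fin t₁) ℂ)
    (G₃₂ : Matrix (Fin r₃) (Fin t₂) ℂ) (P : ℝ) :
    ∃ k ≤ min t₁ r₂, ∀ μ : ProbabilityMeasure ((Fin t₁ → ℂ) × (Fin t₂ → ℂ)),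
      PowerConstraint P μ (fun e => e.1) → PowerConstraint P μ (fun e => e.2) →
      cutsetRate G₂₁ G₃₁ G₃₂ μ ≤ pdfRate G₂₁ G₃₁ G₃₂ (relayCopyLaw G₂₁ μ) + k := by
  obtain ⟨k, hk, hgap⟩ := exists_condRelEntropy_outputY₂_le (t₂ := t₂) (r₃ := r₃) G₂₁
  obtain ⟨B₂, hB₂, hb₂⟩ := exists_lintegral_normSq_mulVec_le G₂₁ P
  obtain ⟨B₃, hB₃, hb₃⟩ := exists_lintegral_normSq_mulVec_add_le G₃₁ G₃₂ P
  refine ⟨k, hk, fun μ hμ₁ hμ₂ => ?_⟩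
  have hforget := measurePreserving_jointLaw_forget (r₃ := r₃) G₂₁ μ
  have hexch := measurePreserving_jointLaw_exchange (r₃ := r₃) G₂₁ μ
  -- With `U - G₂₁ X₁` as relay noise the relay output is `U`; the exchange map thus turns
  -- conditioning on `Y₂` into conditioning on `U`.
  have hout (x : Fin t₁ → ℂ) (u : Fin r₂ → ℂ) : outputY₂ G₂₁ x (u - G₂₁ *ᵥ x) = u := by
    simp [outputY₂]
  have hlog0 : ENNReal.ofReal (Real.log 2) ≠ 0 := by simpa using Real.log_pos one_lt_two
  have hlogtop : ENNReal.ofReal (Real.log 2) ≠ ∞ := ENNReal.ofReal_ne_top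
  simp only [cutsetRate, pdfRate]
  rw [← min_add_add_right]
  refine min_le_min ?_ ?_
  · refine le_add_right (le_of_eq ?_)
    exact (mutualInfo_comp_measurePreserving hforget (by fun_prop) (by fun_prop)).symm
  have hcs := condMutualInfo_mul_log_two_add (jointLaw r₂ r₃ μ)
    ((complexGaussianVec r₂).prod (complexGaussianVec r₃)) (Z := fun ω => ω.1.2)
    (X := fun ω => ω.1.1)
    (Y := fun ω => (outputY₂ G₂₁ ω.1.1 ω.2.1, outputY₃ G₃₁ G₃₂ ω.1.1 ω.1.2 ω.2.2))
    (by fun_prop) (by fun_prop) (by fun_prop)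
  rw [condRelEntropy_prod _ _ _ (by fun_prop) (by fun_prop) (by fun_prop),
    condRelEntropy_prod _ _ _ (by fun_prop) (by fun_prop) (by fun_prop)] at hcs
  have hpdf₂ := condMutualInfo_mul_log_two_add (jointLaw r₂ r₃ (relayCopyLaw G₂₁ μ))
    (complexGaussianVec r₂) (Z := fun ω => ω.1.2.2) (X := fun ω => ω.1.1)
    (Y := fun ω => outputY₂ G₂₁ ω.1.2.1 ω.2.1) (by fun_prop) (by fun_prop) (by fun_prop)
  have hpdf₃ := condMutualInfo_mul_log_two_add (jointLaw r₂ r₃ (relayCopyLaw G₂₁ μ))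
    (complexGaussianVec r₃) (Z := fun ω => (ω.1.2.2, ω.1.1)) (X := fun ω => ω.1.2.1)
    (Y := fun ω => outputY₃ G₃₁ G₃₂ ω.1.2.1 ω.1.2.2 ω.2.2)
    (by fun_prop) (by fun_prop) (by fun_prop)
  have hside₂ := condRelEntropy_comp_measurePreserving hforget (Z := fun ω => ω.1.2)
    (Y := fun ω => outputY₂ G₂₁ ω.1.1 ω.2.1) (by fun_prop) (by fun_prop) (complexGaussianVec r₂)
  have hside₃ := condRelEntropy_comp_measurePreserving hexch
    (Z := fun ω => (ω.1.2, outputY₂ G₂₁ ω.1.1 ω.2.1))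
    (Y := fun ω => outputY₃ G₃₁ G₃₂ ω.1.1 ω.1.2 ω.2.2) (by fun_prop) (by fun_prop)
    (complexGaussianVec r₃)
  have hfull₃ := condRelEntropy_comp_measurePreserving hexch
    (Z := fun ω => ((ω.1.2, outputY₂ G₂₁ ω.1.1 ω.2.1), ω.1.1))
    (Y := fun ω => outputY₃ G₃₁ G₃₂ ω.1.1 ω.1.2 ω.2.2) (by fun_prop) (by fun_prop)
    (complexGaussianVec r₃)
  -- The two chain rules list the conditioning variables `X₂, X₁, Y₂` in different orders.
  have hswap := condRelEntropy_of_leftInverse (jointLaw r₂ r₃ μ) (complexGaussianVec r₃)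
    (Z := fun ω => ((ω.1.2, outputY₂ G₂₁ ω.1.1 ω.2.1), ω.1.1))
    (Y := fun ω => outputY₃ G₃₁ G₃₂ ω.1.1 ω.1.2 ω.2.2) (by fun_prop) (by fun_prop)
    (f := fun p => ((p.1.1, p.2), p.1.2)) (g := fun p => ((p.1.1, p.2), p.1.2)) (by fun_prop)
    (by fun_prop) (fun _ => rfl)
  simp only [hout] at hside₃ hfull₃
  have hpow₂ := hb₂ μ (fun e => e.1) measurable_fst hμ₁
  have hle₂ := condRelEntropy_outputY₂_le (r₃ := r₃) G₂₁ μ (g := fun e => (e.2, e.1))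
    (by fun_prop) (x₁ := Prod.snd) measurable_snd
  have hle₃ := (condRelEntropy_outputY₃_le G₃₁ G₃₂ μ
    (g := fun p => ((p.1.2, p.1.1), outputY₂ G₂₁ p.1.1 p.2)) (by fun_prop)
    (x₁ := fun a => a.1.2) (by fun_prop) (x₂ := fun a => a.1.1) (by fun_prop)
    measurable_fst measurable_snd (fun _ => rfl) (fun _ => rfl)).trans
    (hb₃ μ _ _ measurable_fst measurable_snd hμ₁ hμ₂)
  -- The signal power links the two estimates: relative entropy of `Y₂` given both inputs ≤ power ≤
  -- relative entropy given `(X₂, U)` plus `k log 2`.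
  have hgap₂ := hle₂.trans (hgap μ (ne_top_of_le_ne_top hB₂ hpow₂))
  rw [hside₂] at hpdf₂
  rw [hside₃, hfull₃, ← hswap] at hpdf₃
  -- The identities are additive in `ℝ≥0∞`; the terms given the side information must be finite
  -- before they can be cancelled.
  have hfin := hcs.trans_ne (ENNReal.add_ne_top.2 ⟨ne_top_of_le_ne_top hB₂ (hle₂.trans hpow₂),
    ne_top_of_le_ne_top hB₃ hle₃⟩)
  have hside := (ENNReal.add_ne_top.1 hfin).2
  rw [← ENNReal.mul_le_mul_iff_left hlog0 hlogtop, ← ENNReal.add_le_add_iff_right hside, hcs]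
  refine (add_le_add_left hgap₂ _).trans (le_of_eq ?_)
  rw [← hpdf₂]
  simp only at hpdf₃ ⊢
  rw [← hpdf₃]
  ring

lemma cutsetBound_le_pdfBound_add (G₂₁ : Matrix (Fin r₂) (Fin t₁) ℂ)
    (G₃₁ : Matrix (Fin r₃) (Fin t₁) ℂ) (G₃₂ : Matrix (Fin r₃) (Fin t₂) ℂ) (P : ℝ) :
    cutsetBound G₂₁ G₃₁ G₃₂ P ≤ pdfBound G₂₁ G₃₁ G₃₂ P + (min t₁ r₂ : ℕ) := by
  obtain ⟨k, hk, h⟩ := exists_cutsetRate_le G₂₁ G₃₁ G₃₂ P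
  refine iSup_le fun μ => iSup_le fun hμ₁ => iSup_le fun hμ₂ => ?_
  refine (h μ hμ₁ hμ₂).trans (add_le_add ?_ (by exact_mod_cast hk))
  exact le_iSup_of_le r₂ <| le_iSup_of_le (relayCopyLaw G₂₁ μ) <|
    le_iSup_of_le (powerConstraint_relayCopyLaw measurable_fst hμ₁) <|
    le_iSup_of_le (powerConstraint_relayCopyLaw measurable_snd hμ₂) le_rfl

/-- The first argument of the minimum is already uniformly bounded. -/
lemma pdfBound_ne_top (G₂₁ : Matrix (Fin r₂) (Fin t₁) ℂ) (G₃₁ : Matrix (Fin r₃) (Fin t₁) ℂ)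
    (G₃₂ : Matrix (Fin r₃) (Fin t₂) ℂ) (P : ℝ) : pdfBound G₂₁ G₃₁ G₃₂ P ≠ ∞ := by
  obtain ⟨B, hB, h⟩ := exists_mutualInfo_outputY₃_le (r₂ := r₂) G₃₁ G₃₂ P
  refine ne_top_of_le_ne_top hB ?_
  refine iSup_le fun d => iSup_le fun μ => iSup_le fun hμ₁ => iSup_le fun hμ₂ => ?_
  exact (min_le_left _ _).trans (h μ (fun e => e.2.1) (fun e => e.2.2) (by fun_prop)
    (by fun_prop) hμ₁ hμ₂)

end Gap

end MIMORelay

end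

theorem theorem1 (t₁ t₂ r₂ r₃ : ℕ)
    (G₂₁ : Matrix (Fin r₂) (Fin t₁) ℂ) (G₃₁ : Matrix (Fin r₃) (Fin t₁) ℂ)
    (G₃₂ : Matrix (Fin r₃) (Fin t₂) ℂ) (P : ℝ) (hP : 0 ≤ P) :
    MIMORelay.cutsetBound G₂₁ G₃₁ G₃₂ P ≠ ∞ ∧
    MIMORelay.pdfBound G₂₁ G₃₁ G₃₂ P ≠ ∞ ∧
    (MIMORelay.cutsetBound G₂₁ G₃₁ G₃₂ P).toReal - (MIMORelay.pdfBound G₂₁ G₃₁ G₃₂ P).toReal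
      ≤ ((min t₁ r₂ : ℕ) : ℝ) := by
  have hle := MIMORelay.cutsetBound_le_pdfBound_add G₂₁ G₃₁ G₃₂ P
  have hpdf := MIMORelay.pdfBound_ne_top G₂₁ G₃₁ G₃₂ P
  have hsum : MIMORelay.pdfBound G₂₁ G₃₁ G₃₂ P + (min t₁ r₂ : ℕ) ≠ ∞ :=
    ENNReal.add_ne_top.2 ⟨hpdf, ENNReal.natCast_ne_top _⟩
  refine ⟨ne_top_of_le_ne_top hsum hle, hpdf, ?_⟩
  have h := ENNReal.toReal_mono hsum hle
  rw [ENNReal.toReal_add hpdf (ENNReal.natCast_ne_top _), ENNReal.toReal_natCast] at h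
  linarith
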